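/- All graphs are finite simple graphs up to isomorphism. Let $\widetilde{\mathbf G}$ be the set of isomorphism classes of finite simple graphs without isolated vertices (the empty graph $\mathbf e$ included), and $\mathbb R\langle\widetilde{\mathbf G}\rangle$ the real vector space with basis $\widetilde{\mathbf G}$. Consider on $\mathbb R\langle\widetilde{\mathbf G}\rangle$ the following linear and bilinear operations, given on basis elements. * $\sqcup$ is the disjoint union, $\Delta_\sqcup(\tau)=\sum_{(\tau_1,\tau_2)\,:\,\tau_1\sqcup\tau_2=\tau}\tau_1\otimes\tau_2$ (sum over pairs in $\widetilde{\mathbf G}\times\widetilde{\mathbf G}$), and $\Delta_{DP}$ is the coproduct that is multiplicative for $\sqcup$, with $\Delta_{DP}(\mathbf e)=\mathbf e\otimes\mathbf e$ and $\Delta_{DP}(\tau)=\tau\otimes\mathbf e+\mathbf e\otimes\tau$ for connected $\tau$. * $\tau_1\star_{E}\tau_2=\sum_{\gamma\in\widetilde{\mathbf G}}\langle\tau_1\otimes\tau_2,\Delta_{E}(\gamma)\rangle\,\gamma$ is the edge-restricted quasi-shuffle product, where $\Delta_{E}(\gamma)=\sum_{A\cup B=E(\gamma)}\gamma|_A\otimes\gamma|_B$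 and $\gamma|_A=(\bigcup_{b\in A}b,\,A)$. * $\tau_1\star_{V}\tau_2=\sum_{\gamma}\langle\tau_1\otimes\tau_2,\Delta_{V}(\gamma)\rangle\,\gamma$ is the vertex-induced quasi-shuffle product, where $\Delta_{V}(\gamma)=\sum_{I\cup J=V(\gamma)}\gamma_I\otimes\gamma_J$ and $\gamma_I$ is the subgraph of $\gamma$ induced by $I$. (For $\tau_1,\tau_2\in\widetilde{\mathbf G}$, only $\gamma\in\widetilde{\mathbf G}$ contribute.) Here $\langle\cdot,\cdot\rangle$ extracts the coefficient of a basis tensor. The unit is always $\mathbf e$, and the counit $\varepsilon$ is given by $\varepsilon(\mathbf e)=1$ and $\varepsilon(\tau)=0$ for $\tau\neq\mathbf e$. For graphs $\tau,\sigma$ let $\mathrm{Mono}(\tau,\sigma)$ and $\mathrm{Epi}(\tau,\sigma)$ be the sets of graph homomorphisms $\tau\to\sigma$ that are injective, respectively surjective, on vertices, and let $\mathrm{RegEpi}(\tau,\sigma)$ be the set of those that are surjective on vertices and on edges. Define linear endomorphisms of $\mathbb R\langle\widetilde{\mathbf G}\rangle$ by $$\Phi_{vi\leftarrow ei}(\tau)=\frac1{|\mathrm{Aut}(\tau)|}\sum_\sigma|\mathrm{Mono}(\tau,\sigma)\cap\mathrm{Epi}(\tau,\sigma)|\,\sigma,\qquad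 \Phi_{ei\leftarrow hom}(\tau)=\sum_\sigma|\mathrm{RegEpi}(\tau,\sigma)|\,\sigma,\qquad \Phi_{vi\leftarrow hom}(\tau)=\sum_\sigma|\mathrm{Epi}(\tau,\sigma)|\,\sigma .$$ **Theorem.** $(\mathbb R\langle\widetilde{\mathbf G}\rangle,\sqcup,\Delta_{DP})$, $(\mathbb R\langle\widetilde{\mathbf G}\rangle,\star_E,\Delta_\sqcup)$ and $(\mathbb R\langle\widetilde{\mathbf G}\rangle,\star_V,\Delta_\sqcup)$ are Hopf algebras, and the maps $$\Phi_{vi\leftarrow ei}:(\mathbb R\langle\widetilde{\mathbf G}\rangle,\star_E,\Delta_\sqcup)\to(\mathbb R\langle\widetilde{\mathbf G}\rangle,\star_V,\Delta_\sqcup),\qquad \Phi_{ei\leftarrow hom}:(\mathbb R\langle\widetilde{\mathbf G}\rangle,\sqcup,\Delta_{DP})\to(\mathbb R\langle\widetilde{\mathbf G}\rangle,\star_E,\Delta_\sqcup)$$ are Hopf algebra isomorphisms. Moreover $\Phi_{vi\leftarrow ei}\circ\Phi_{ei\leftarrow hom}=\Phi_{vi\leftarrow hom}$, and in particular $$\Phi_{vi\leftarrow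 hom}:(\mathbb R\langle\widetilde{\mathbf G}\rangle,\sqcup,\Delta_{DP})\to(\mathbb R\langle\widetilde{\mathbf G}\rangle,\star_V,\Delta_\sqcup)$$ is a Hopf algebra isomorphism as well. -/

import Mathlib

open scoped TensorProduct

noncomputable section

/-! ### Finite simple graphs up to isomorphism -/

/-- Two finite simple graphs on initial segments of `ℕ` are identified when they are isomorphic. -/
instance finGraphSetoid : Setoid (Σ n : ℕ, SimpleGraph (Fin n)) where
  r G H := Nonempty (G.2 ≃g H.2)
  iseqv :=
    { refl := fun _ => ⟨SimpleGraph.Iso.refl⟩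
      symm := fun ⟨e⟩ => ⟨e.symm⟩
      trans := fun ⟨e⟩ ⟨f⟩ => ⟨f.comp e⟩ }

/-- The set of isomorphism classes of finite simple graphs (isolated vertices are allowed). -/
def FinGraph : Type := Quotient finGraphSetoid

namespace FinGraph

/-- The isomorphism class of a simple graph on a finite vertex set. -/
def mk {V : Type} [Finite V] (G : SimpleGraph V) : FinGraph :=
  Quotient.mk finGraphSetoid ⟨Nat.card V, G.comap (Finite.equivFin V).symm⟩

/-- The number of vertices of (a representative of) an isomorphism class. -/
def order (τ : FinGraph) : ℕ := (Quotient.out τ).1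

/-- A representative of an isomorphism class.  Everything below that is computed from the
representative is invariant under graph isomorphisms. -/
def graph (τ : FinGraph) : SimpleGraph (Fin τ.order) := (Quotient.out τ).2

theorem mk_graph_iso {V : Type} [Finite V] (G : SimpleGraph V) :
    Nonempty ((mk G).graph ≃g G) := by
  have h : (Quotient.out (mk G)) ≈ ⟨Nat.card V, G.comap (Finite.equivFin V).symm⟩ :=
    Quotient.mk_out _
  obtain ⟨e⟩ := h
  exact ⟨(SimpleGraph.Iso.comap (Finite.equivFin V).symm G).comp e⟩

theorem order_mk {V : Type} [Finite V] (G : SimpleGraph V) : (mk G).order = Nat.card V := by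
  obtain ⟨e⟩ := mk_graph_iso G
  simpa using Nat.card_congr e.toEquiv

theorem mk_eq_mk {V W : Type} [Finite V] [Finite W] {G : SimpleGraph V} {H : SimpleGraph W} :
    mk G = mk H ↔ Nonempty (G ≃g H) := by
  constructor
  · intro h
    obtain ⟨e⟩ := mk_graph_iso G
    obtain ⟨f⟩ := mk_graph_iso H
    rw [← h] at f
    exact ⟨f.comp e.symm⟩
  · rintro ⟨e⟩
    exact Quotient.sound ⟨((SimpleGraph.Iso.comap (Finite.equivFin W).symm H).symm.comp e).comp
      (SimpleGraph.Iso.comap (Finite.equivFin V).symm G)⟩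

theorem mk_graph (τ : FinGraph) : mk τ.graph = τ := by
  have h : mk τ.graph = Quotient.mk finGraphSetoid (Quotient.out τ) :=
    Quotient.sound ⟨SimpleGraph.Iso.comap (Finite.equivFin (Fin τ.order)).symm τ.graph⟩
  exact h.trans (Quotient.out_eq τ)

theorem finite_order_le (N : ℕ) : {τ : FinGraph | τ.order ≤ N}.Finite := by
  refine (Set.finite_range (fun p : Σ n : Fin (N + 1), SimpleGraph (Fin n) =>
    (Quotient.mk finGraphSetoid ⟨p.1, p.2⟩ : FinGraph))).subset ?_
  intro (τ : FinGraph) hτ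
  exact ⟨⟨⟨τ.order, Nat.lt_succ_of_le hτ⟩, τ.graph⟩, Quotient.out_eq τ⟩

end FinGraph

/-- A simple graph has no isolated vertices. -/
def NoIsolated {V : Type} (G : SimpleGraph V) : Prop := ∀ v, ∃ w, G.Adj v w

theorem NoIsolated.of_iso {V W : Type} {G : SimpleGraph V} {H : SimpleGraph W}
    (hG : NoIsolated G) (e : G ≃g H) : NoIsolated H := by
  intro w
  obtain ⟨v, hv⟩ := hG (e.symm w)
  exact ⟨e v, by simpa using e.map_rel_iff.2 hv⟩

/-- The set of isomorphism classes of finite simple graphs without isolated vertices. -/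
def FinGraphNo : Type := {τ : FinGraph // NoIsolated τ.graph}

namespace FinGraphNo

/-- The isomorphism class of a finite graph without isolated vertices. -/
def mk {V : Type} [Finite V] (G : SimpleGraph V) (hG : NoIsolated G) : FinGraphNo :=
  ⟨FinGraph.mk G, hG.of_iso (FinGraph.mk_graph_iso G).some.symm⟩

/-- The number of vertices. -/
def order (τ : FinGraphNo) : ℕ := τ.1.order

/-- A representative of the isomorphism class. -/
def graph (τ : FinGraphNo) : SimpleGraph (Fin τ.order) := τ.1.graph

theorem noIsolated (τ : FinGraphNo) : NoIsolated τ.graph := τ.2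

theorem order_mk {V : Type} [Finite V] (G : SimpleGraph V) (hG : NoIsolated G) :
    (mk G hG).order = Nat.card V := FinGraph.order_mk G

theorem finite_order_le (N : ℕ) : {τ : FinGraphNo | τ.order ≤ N}.Finite :=
  (FinGraph.finite_order_le N).preimage Subtype.val_injective.injOn

/-- The empty graph. -/
def empty : FinGraphNo := mk (⊥ : SimpleGraph (Fin 0)) (fun v => v.elim0)

theorem noIsolated_sum (σ τ : FinGraphNo) : NoIsolated (σ.graph ⊕g τ.graph) := by
  rintro (v | v)
  · obtain ⟨w, hw⟩ := σ.noIsolated v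
    exact ⟨Sum.inl w, hw⟩
  · obtain ⟨w, hw⟩ := τ.noIsolated v
    exact ⟨Sum.inr w, hw⟩

/-- The disjoint union of two graphs. -/
def disjUnion (σ τ : FinGraphNo) : FinGraphNo := mk (σ.graph ⊕g τ.graph) (noIsolated_sum σ τ)

theorem order_disjUnion (σ τ : FinGraphNo) : (disjUnion σ τ).order = σ.order + τ.order := by
  rw [disjUnion, order_mk]
  simp

/-- The end points of the edges in `A`. -/
def support (τ : FinGraphNo) (A : Set τ.graph.edgeSet) : Set (Fin τ.order) :=
  {v | ∃ b ∈ A, v ∈ (b : Sym2 (Fin τ.order))}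

/-- The restricted subgraph `(⋃_{b ∈ A} b, A)` for a set `A` of edges of `τ`, as a graph. -/
def restrictGraph (τ : FinGraphNo) (A : Set τ.graph.edgeSet) : SimpleGraph (τ.support A) :=
  (SimpleGraph.fromEdgeSet (Subtype.val '' A)).induce (τ.support A)

theorem noIsolated_restrictGraph (τ : FinGraphNo) (A : Set τ.graph.edgeSet) :
    NoIsolated (τ.restrictGraph A) := by
  rintro ⟨v, b, hb, hv⟩
  obtain ⟨w, hw⟩ := hv
  have hadj : τ.graph.Adj v w := by
    have := b.2
    rw [hw] at this
    exact this
  refine ⟨⟨w, b, hb, by rw [hw]; exact Sym2.mem_mk_right v w⟩, ?_⟩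
  simp only [restrictGraph, SimpleGraph.comap_adj, Function.Embedding.subtype_apply,
    SimpleGraph.fromEdgeSet_adj]
  exact ⟨⟨b, hb, hw⟩, hadj.ne⟩

/-- The class of the restricted subgraph `(⋃_{b ∈ A} b, A)`. -/
def restrict (τ : FinGraphNo) (A : Set τ.graph.edgeSet) : FinGraphNo :=
  mk (τ.restrictGraph A) (τ.noIsolated_restrictGraph A)

/-- The union of the connected components of `τ` that belong to `S`, as a graph. -/
def componentsGraph (τ : FinGraphNo) (S : Set τ.graph.ConnectedComponent) :
    SimpleGraph {v : Fin τ.order | τ.graph.connectedComponentMk v ∈ S} :=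
  τ.graph.induce {v | τ.graph.connectedComponentMk v ∈ S}

theorem noIsolated_componentsGraph (τ : FinGraphNo) (S : Set τ.graph.ConnectedComponent) :
    NoIsolated (τ.componentsGraph S) := by
  rintro ⟨v, hv⟩
  obtain ⟨w, hw⟩ := τ.noIsolated v
  refine ⟨⟨w, ?_⟩, hw⟩
  have : τ.graph.connectedComponentMk w = τ.graph.connectedComponentMk v :=
    SimpleGraph.ConnectedComponent.sound hw.symm.reachable
  simpa [this] using hv

/-- The class of the union of the connected components of `τ` that belong to `S`. -/
def components (τ : FinGraphNo) (S : Set τ.graph.ConnectedComponent) : FinGraphNo :=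
  mk (τ.componentsGraph S) (τ.noIsolated_componentsGraph S)

end FinGraphNo

/-- The class of the subgraph of `τ` induced by a set `U` of vertices. -/
def FinGraph.induced (τ : FinGraph) (U : Set (Fin τ.order)) : FinGraph :=
  FinGraph.mk (τ.graph.induce U)

/-! ### The free vector spaces on graphs -/

/-- The real vector space with basis all finite graphs. -/
abbrev LGraph : Type := FinGraph →₀ ℝ

/-- The real vector space with basis the finite graphs without isolated vertices. -/
abbrev LGraphNo : Type := FinGraphNo →₀ ℝ

/-- The element `τ` of the basis. -/
def gr (τ : FinGraphNo) : LGraphNo := Finsupp.single τ 1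

/-- The linear extension of a function given on the basis. -/
def linExt {M : Type} [AddCommGroup M] [Module ℝ M] (f : FinGraphNo → M) : LGraphNo →ₗ[ℝ] M :=
  Finsupp.linearCombination ℝ f

/-- The bilinear extension of a function given on pairs of elements of the basis. -/
def bilinExt (f : FinGraphNo → FinGraphNo → LGraphNo) : LGraphNo →ₗ[ℝ] LGraphNo →ₗ[ℝ] LGraphNo :=
  linExt fun σ => linExt (f σ)

/-- The coefficient `⟨σ ⊗ τ, x⟩` of `σ ⊗ τ` in the tensor `x`. -/
def tensorCoeff {α : Type} (σ τ : α) (x : (α →₀ ℝ) ⊗[ℝ] (α →₀ ℝ)) : ℝ :=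
  finsuppTensorFinsupp' ℝ α α x (σ, τ)

/-- The sum `∑_γ c(γ) γ`, for coefficients `c` that vanish on graphs with many vertices. -/
def sumGraphs (c : FinGraphNo → ℝ) (N : ℕ) (hc : ∀ γ, c γ ≠ 0 → γ.order ≤ N) : LGraphNo :=
  Finsupp.ofSupportFinite c ((FinGraphNo.finite_order_le N).subset hc)

/-! ### Products and coproducts -/

/-- The disjoint union product. -/
def mulDisj : LGraphNo →ₗ[ℝ] LGraphNo →ₗ[ℝ] LGraphNo :=
  bilinExt fun σ τ => gr (σ.disjUnion τ)

theorem finite_disjUnion_eq (τ : FinGraphNo) :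
    {p : FinGraphNo × FinGraphNo | p.1.disjUnion p.2 = τ}.Finite := by
  refine ((FinGraphNo.finite_order_le τ.order).prod
    (FinGraphNo.finite_order_le τ.order)).subset ?_
  rintro ⟨σ, ρ⟩ h
  have h' : σ.disjUnion ρ = τ := h
  have := FinGraphNo.order_disjUnion σ ρ
  rw [h'] at this
  exact ⟨show σ.order ≤ τ.order by omega, show ρ.order ≤ τ.order by omega⟩

/-- The coproduct dual to the disjoint union:
`Δ_⊔(τ) = ∑ τ₁ ⊗ τ₂` over all pairs of graphs with `τ₁ ⊔ τ₂ = τ`. -/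
def comulDisj : LGraphNo →ₗ[ℝ] LGraphNo ⊗[ℝ] LGraphNo :=
  linExt fun τ => ∑ p ∈ (finite_disjUnion_eq τ).toFinset, gr p.1 ⊗ₜ[ℝ] gr p.2

open scoped Classical in
/-- The divided powers coproduct `Δ_DP`: it is `c ⊗ e + e ⊗ c` on a connected graph `c`, and it is
multiplicative for the disjoint union.  On `τ`, the disjoint union of its components, expanding
the product of the `c ⊗ e + e ⊗ c` over the components `c` gives the sum over all sets `S` of
components. -/
def comulDP : LGraphNo →ₗ[ℝ] LGraphNo ⊗[ℝ] LGraphNo :=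
  linExt fun τ => ∑ S : Set τ.graph.ConnectedComponent,
    gr (τ.components S) ⊗ₜ[ℝ] gr (τ.components Sᶜ)

/-- On connected graphs the divided powers coproduct is primitive. -/
theorem comulDP_connected (τ : FinGraphNo) (hτ : τ.graph.Connected) :
    comulDP (gr τ) = gr τ ⊗ₜ[ℝ] gr FinGraphNo.empty + gr FinGraphNo.empty ⊗ₜ[ℝ] gr τ := by
  classical
  have h0 : τ.components ∅ = FinGraphNo.empty := by
    apply Subtype.ext
    have he : ∀ v : {v : Fin τ.order | τ.graph.connectedComponentMk v ∈
        (∅ : Set τ.graph.ConnectedComponent)}, False := fun v => v.2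
    exact FinGraph.mk_eq_mk.2 ⟨⟨⟨fun v => (he v).elim, fun v => v.elim0,
      fun v => (he v).elim, fun v => v.elim0⟩, fun {v} => (he v).elim⟩⟩
  have h1 : τ.components Set.univ = τ := by
    apply Subtype.ext
    refine Eq.trans (FinGraph.mk_eq_mk.2 ⟨⟨⟨fun v => v.1, fun v => ⟨v, trivial⟩,
      fun _ => rfl, fun _ => rfl⟩, ?_⟩⟩) (FinGraph.mk_graph τ.1)
    intro v w
    rfl
  have hsub : Subsingleton τ.graph.ConnectedComponent :=
    hτ.preconnected.subsingleton_connectedComponent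
  have hne : Nonempty τ.graph.ConnectedComponent :=
    hτ.nonempty.map τ.graph.connectedComponentMk
  have hu : (Finset.univ : Finset (Set τ.graph.ConnectedComponent)) = {Set.univ, ∅} := by
    ext S
    simpa [or_comm] using Set.eq_empty_or_nonempty S |>.imp id fun h =>
      Subsingleton.eq_univ_of_nonempty h
  have huv : (Set.univ : Set τ.graph.ConnectedComponent) ≠ ∅ := Set.univ_nonempty.ne_empty
  have hg : comulDP (gr τ) = ∑ S : Set τ.graph.ConnectedComponent,
      gr (τ.components S) ⊗ₜ[ℝ] gr (τ.components Sᶜ) := by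
    simp only [comulDP, linExt, gr, Finsupp.linearCombination_single, one_smul]
  rw [hg]
  rw [show (∑ S : Set τ.graph.ConnectedComponent,
      gr (τ.components S) ⊗ₜ[ℝ] gr (τ.components Sᶜ)) = ∑ S ∈ {Set.univ, ∅},
      gr (τ.components S) ⊗ₜ[ℝ] gr (τ.components Sᶜ) by rw [← hu]]
  rw [Finset.sum_pair huv, Set.compl_univ, Set.compl_empty, h0, h1]

open scoped Classical in
/-- The edge-restricted co-quasi-shuffle of a graph: the sum of `τ|_A ⊗ τ|_B` over all sets of
edges `A`, `B` with `E(τ) ∖ A ⊆ B`. -/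
def coQsGraph (τ : FinGraphNo) : LGraphNo ⊗[ℝ] LGraphNo :=
  ∑ p : Set τ.graph.edgeSet × Set τ.graph.edgeSet with p.1ᶜ ⊆ p.2,
    gr (τ.restrict p.1) ⊗ₜ[ℝ] gr (τ.restrict p.2)

open scoped Classical in
/-- The vertex-induced co-quasi-shuffle of a graph: the sum of `τ_I ⊗ τ_J` over all sets of
vertices `I`, `J` with `V(τ) ∖ I ⊆ J`. -/
def coQisGraph (τ : FinGraph) : LGraph ⊗[ℝ] LGraph :=
  ∑ p : Set (Fin τ.order) × Set (Fin τ.order) with p.1ᶜ ⊆ p.2,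
    Finsupp.single (τ.induced p.1) (1 : ℝ) ⊗ₜ[ℝ] Finsupp.single (τ.induced p.2) (1 : ℝ)

theorem exists_of_tensorCoeff_ne_zero {α ι : Type} {σ τ : α} {s : Finset ι} {f g : ι → α}
    (h : tensorCoeff σ τ (∑ i ∈ s, Finsupp.single (f i) (1 : ℝ) ⊗ₜ[ℝ]
      Finsupp.single (g i) (1 : ℝ)) ≠ 0) : ∃ i ∈ s, f i = σ ∧ g i = τ := by
  classical
  by_contra! hne
  apply h
  simp only [tensorCoeff, map_sum, Finsupp.finsetSum_apply,
    finsuppTensorFinsupp'_single_tmul_single]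
  refine Finset.sum_eq_zero fun i hi => ?_
  rw [Finsupp.single_apply, if_neg]
  intro he
  exact hne i hi (Prod.ext_iff.1 he).1 (Prod.ext_iff.1 he).2

theorem le_add_of_union {n : ℕ} {s t : Set (Fin n)} (h : ∀ v, v ∈ s ∨ v ∈ t) :
    n ≤ Nat.card s + Nat.card t := by
  have hu : s ∪ t = Set.univ := Set.eq_univ_of_forall h
  calc n = (s ∪ t).ncard := by rw [hu]; simp [Set.ncard_univ]
    _ ≤ s.ncard + t.ncard := Set.ncard_union_le s t
    _ = Nat.card s + Nat.card t := by rfl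

theorem order_le_of_qs {σ τ γ : FinGraphNo} (h : tensorCoeff σ τ (coQsGraph γ) ≠ 0) :
    γ.order ≤ σ.order + τ.order := by
  obtain ⟨⟨A, B⟩, hAB, rfl, rfl⟩ := exists_of_tensorCoeff_ne_zero h
  have hAB' : Aᶜ ⊆ B := by simpa using hAB
  rw [FinGraphNo.restrict, FinGraphNo.restrict, FinGraphNo.order_mk, FinGraphNo.order_mk]
  apply le_add_of_union
  intro v
  obtain ⟨w, hw⟩ := γ.noIsolated v
  let b : γ.graph.edgeSet := ⟨s(v, w), hw⟩
  have hv : v ∈ (b : Sym2 (Fin γ.order)) := Sym2.mem_mk_left v w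
  by_cases hb : b ∈ A
  · exact Or.inl ⟨b, hb, hv⟩
  · exact Or.inr ⟨b, hAB' hb, hv⟩

theorem order_le_of_qis {σ τ γ : FinGraph} (h : tensorCoeff σ τ (coQisGraph γ) ≠ 0) :
    γ.order ≤ σ.order + τ.order := by
  obtain ⟨⟨I, J⟩, hIJ, rfl, rfl⟩ := exists_of_tensorCoeff_ne_zero h
  have hIJ' : Iᶜ ⊆ J := by simpa using hIJ
  rw [FinGraph.induced, FinGraph.induced, FinGraph.order_mk, FinGraph.order_mk]
  apply le_add_of_union
  intro v
  by_cases hv : v ∈ I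
  · exact Or.inl hv
  · exact Or.inr (hIJ' hv)

/-- The product of two graphs without isolated vertices for the vertex-induced quasi-shuffle only
involves graphs without isolated vertices, so that the product restricts to their span. -/
theorem noIsolated_of_qis {σ τ : FinGraphNo} {γ : FinGraph}
    (h : tensorCoeff σ.1 τ.1 (coQisGraph γ) ≠ 0) : NoIsolated γ.graph := by
  obtain ⟨⟨I, J⟩, hIJ, hI, hJ⟩ := exists_of_tensorCoeff_ne_zero h
  have hIJ' : Iᶜ ⊆ J := by simpa using hIJ
  have key : ∀ (U : Set (Fin γ.order)) (ρ : FinGraphNo), γ.induced U = ρ.1 →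
      ∀ v ∈ U, ∃ w, γ.graph.Adj v w := by
    intro U ρ hU v hv
    have hρ := ρ.2
    rw [← hU] at hρ
    obtain ⟨w, hw⟩ := hρ.of_iso (FinGraph.mk_graph_iso (γ.graph.induce U)).some ⟨v, hv⟩
    exact ⟨w, hw⟩
  intro v
  by_cases hv : v ∈ I
  · exact key I σ hI v hv
  · exact key J τ hJ v (hIJ' hv)

/-- The quasi-shuffle product on graphs without isolated vertices, dual to the edge-restricted
co-quasi-shuffle: the coefficient of `γ` in the product of `σ` and `τ` is that of `σ ⊗ τ` in the
coproduct of `γ`. -/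
def mulQs : LGraphNo →ₗ[ℝ] LGraphNo →ₗ[ℝ] LGraphNo :=
  bilinExt fun σ τ => sumGraphs (fun γ => tensorCoeff σ τ (coQsGraph γ)) (σ.order + τ.order)
    (fun _ h => order_le_of_qs h)

/-- The quasi-shuffle product dual to the vertex-induced co-quasi-shuffle, restricted to graphs
without isolated vertices. -/
def mulQis : LGraphNo →ₗ[ℝ] LGraphNo →ₗ[ℝ] LGraphNo :=
  bilinExt fun σ τ => sumGraphs (fun γ => tensorCoeff σ.1 τ.1 (coQisGraph γ.1))
    (σ.order + τ.order) (fun _ h => order_le_of_qis h)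

/-- The common counit: `1` on the empty graph, `0` on all other graphs. -/
def counitGraph : LGraphNo →ₗ[ℝ] ℝ :=
  open scoped Classical in linExt fun τ => if τ = FinGraphNo.empty then 1 else 0

/-! ### Hopf algebras -/

/-- A product, a unit, a coproduct and a counit on a real vector space. -/
structure HopfOps (V : Type) [AddCommGroup V] [Module ℝ V] where
  mul : V →ₗ[ℝ] V →ₗ[ℝ] V
  one : V
  comul : V →ₗ[ℝ] V ⊗[ℝ] V
  counit : V →ₗ[ℝ] ℝ

/-- The given operations form a Hopf algebra: a Hopf algebra together with a linear isomorphism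
that identifies its product, unit, coproduct and counit with the given ones. -/
structure HopfOps.AsHopfAlgebra {V : Type} [AddCommGroup V] [Module ℝ V] (O : HopfOps V) where
  carrier : Type
  [ring : Ring carrier]
  [hopf : HopfAlgebra ℝ carrier]
  equiv : V ≃ₗ[ℝ] carrier
  map_mul : ∀ x y, equiv (O.mul x y) = equiv x * equiv y
  map_one : equiv O.one = 1
  map_comul : ∀ x, Coalgebra.comul (R := ℝ) (equiv x) =
    TensorProduct.map equiv.toLinearMap equiv.toLinearMap (O.comul x)
  map_counit : ∀ x, Coalgebra.counit (R := ℝ) (equiv x) = O.counit x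

attribute [instance] HopfOps.AsHopfAlgebra.ring HopfOps.AsHopfAlgebra.hopf

/-- The linear map `φ` is an isomorphism of Hopf algebras; in particular the operations on both
sides form Hopf algebras. -/
def IsHopfIso {V W : Type} [AddCommGroup V] [Module ℝ V] [AddCommGroup W] [Module ℝ W]
    (O₁ : HopfOps V) (O₂ : HopfOps W) (φ : V →ₗ[ℝ] W) : Prop :=
  ∃ (H₁ : O₁.AsHopfAlgebra) (H₂ : O₂.AsHopfAlgebra) (f : H₁.carrier ≃ₐc[ℝ] H₂.carrier),
    (∀ a, f (HopfAlgebra.antipode ℝ a) = HopfAlgebra.antipode ℝ (f a)) ∧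
    ∀ x, f (H₁.equiv x) = H₂.equiv (φ x)

/-- The polynomial Hopf algebra: disjoint union and divided powers coproduct. -/
def polyOps : HopfOps LGraphNo := ⟨mulDisj, gr FinGraphNo.empty, comulDP, counitGraph⟩

/-- The edge-restricted quasi-shuffle product with the coproduct dual to the disjoint union. -/
def qsOps : HopfOps LGraphNo := ⟨mulQs, gr FinGraphNo.empty, comulDisj, counitGraph⟩

/-- The vertex-induced quasi-shuffle product with the coproduct dual to the disjoint union. -/
def qisOps : HopfOps LGraphNo := ⟨mulQis, gr FinGraphNo.empty, comulDisj, counitGraph⟩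

/-! ### The translation maps -/

/-- Homomorphisms that are surjective on vertices. -/
def Epi (τ σ : FinGraphNo) : Set (τ.graph →g σ.graph) := {f | Function.Surjective f}

/-- Homomorphisms that are injective on vertices. -/
def Mono (τ σ : FinGraphNo) : Set (τ.graph →g σ.graph) := {f | Function.Injective f}

/-- Homomorphisms that are surjective on vertices and on edges. -/
def RegEpi (τ σ : FinGraphNo) : Set (τ.graph →g σ.graph) :=
  {f | Function.Surjective f ∧ Function.Surjective f.mapEdgeSet}

theorem regEpi_subset_epi (τ σ : FinGraphNo) : RegEpi τ σ ⊆ Epi τ σ := fun _ hf => hf.1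

/-- The number of automorphisms of a graph. -/
def numAut (τ : FinGraphNo) : ℕ := Nat.card (τ.graph ≃g τ.graph)

theorem order_le_of_epi {τ σ : FinGraphNo} {s : Set (τ.graph →g σ.graph)} (hs : s ⊆ Epi τ σ)
    (h : s.ncard ≠ 0) : σ.order ≤ τ.order := by
  obtain ⟨f, hf⟩ := Set.nonempty_of_ncard_ne_zero h
  simpa using Fintype.card_le_of_surjective f (hs hf)

/-- The image of a graph without isolated vertices under a homomorphism that is surjective on
vertices has no isolated vertices: graphs with isolated vertices need not be summed over below. -/
theorem noIsolated_of_epi {τ : FinGraphNo} {W : Type} {G : SimpleGraph W} (f : τ.graph →g G)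
    (hf : Function.Surjective f) : NoIsolated G := by
  intro w
  obtain ⟨v, rfl⟩ := hf w
  obtain ⟨u, hu⟩ := τ.noIsolated v
  exact ⟨f u, f.map_adj hu⟩

/-- `Φ_{vi←ei}(τ) = |Aut(τ)|⁻¹ ∑_σ |Mono(τ, σ) ∩ Epi(τ, σ)| σ`. -/
def PhiViEi : LGraphNo →ₗ[ℝ] LGraphNo :=
  linExt fun τ => (1 / (numAut τ : ℝ)) • sumGraphs (fun σ => ((Mono τ σ ∩ Epi τ σ).ncard : ℝ))
    τ.order (fun _ h => order_le_of_epi Set.inter_subset_right (by exact_mod_cast h))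

/-- `Φ_{ei←hom}(τ) = ∑_σ |RegEpi(τ, σ)| σ`. -/
def PhiEiHom : LGraphNo →ₗ[ℝ] LGraphNo :=
  linExt fun τ => sumGraphs (fun σ => ((RegEpi τ σ).ncard : ℝ))
    τ.order (fun _ h => order_le_of_epi (regEpi_subset_epi τ _) (by exact_mod_cast h))

/-- `Φ_{vi←hom}(τ) = ∑_σ |Epi(τ, σ)| σ`. -/
def PhiViHom : LGraphNo →ₗ[ℝ] LGraphNo :=
  linExt fun τ => sumGraphs (fun σ => ((Epi τ σ).ncard : ℝ))
    τ.order (fun _ h => order_le_of_epi subset_rfl (by exact_mod_cast h))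

end

/-!
Let `Φ r` be the linear map that sends a graph `τ` to the sum of all graphs `σ`, each weighted by
the number of homomorphisms `τ → σ` that are surjective on vertices and, if `r` holds, also on
edges (`surjMap`).  It is `Φ_{ei←hom}` for `r = True` and `Φ_{vi←hom}` for `r = False`.

*Compatibility with the operations.*  A homomorphism `σ ⊔ τ → γ` is a pair of homomorphisms, and it
is surjective if and only if the images of the two parts cover `γ`; here images are sets of edges
if `r` holds and sets of vertices otherwise.  Grouping the pairs by their images gives the
coefficient of `γ` in a quasi-shuffle product (`surjCount_true_sum_left`,
`surjCount_false_sum_left`).  A surjection `τ → σ₁ ⊔ σ₂` splits the set of components of `τ` into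
two complementary sets, one mapped onto `σ₁` and the other onto `σ₂`; this turns the divided powers
coproduct into the coproduct dual to the disjoint union (`surjCount_sum_right`).

*Bijectivity.*  If `σ` is a surjective image of `τ` that is not isomorphic to `τ`, then `σ` has
fewer vertices, or as many vertices and more edges (`graphRank_lt`).  So `Φ r` is triangular for a
well-founded rank, and its diagonal coefficients are not zero, because of the identity
homomorphisms (`surjMap_bijective`).

*Hopf algebras.*  It remains to see that the polynomial operations form a Hopf algebra: the others
are then Hopf algebras by transport along `Φ r`.  The product is that of the monoid algebra of the
graphs under disjoint union.  Coassociativity is transported from the coproduct dual to the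
disjoint union, where it is the associativity of `⊔`.  The divided powers coproduct is
multiplicative because a set of components of `σ ⊔ τ` is a pair of sets of components
(`comulDP_gr_disjUnion`).  The antipode multiplies a graph with `n` components by `(-1) ^ n`; its
axioms amount to the vanishing of the alternating sum over the subsets of a nonempty set.

*Composition.*  A homomorphism onto all vertices of `γ` is surjective on the edges of a unique
spanning subgraph of `γ`, its image, and the bijective homomorphisms `σ → γ`, counted up to
automorphisms of `σ`, are the spanning subgraphs of `γ` isomorphic to `σ`
(`surjCount_false_eq_sum`, `card_bijective_hom`).  Hence `Φ_{vi←ei} ∘ Φ_{ei←hom} = Φ_{vi←hom}`, and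
`Φ_{vi←ei}` inherits bijectivity and compatibility from the other two maps.
-/

noncomputable section

/-! ### Hopf algebras from operations, and transport along linear isomorphisms -/

theorem tensor_mul_eq_map₂ {A : Type} [Ring A] [Algebra ℝ A] (s t : A ⊗[ℝ] A) :
    s * t = TensorProduct.map₂ (LinearMap.mul ℝ A) (LinearMap.mul ℝ A) s t := by
  induction s with
  | zero => simp
  | add s₁ s₂ h₁ h₂ => simp only [add_mul, map_add, LinearMap.add_apply, h₁, h₂]
  | tmul a b =>
    induction t with
    | zero => simp
    | add t₁ t₂ h₁ h₂ => simp only [mul_add, map_add, h₁, h₂]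
    | tmul c d => simp

namespace HopfOps

variable {V W : Type} [AddCommGroup V] [Module ℝ V] [AddCommGroup W] [Module ℝ W]

/-- The Hopf algebra axioms for a product, a unit, a coproduct and a counit on a vector space,
written as equations in that space, together with an antipode `S`. -/
structure IsHopf (O : HopfOps V) (S : V →ₗ[ℝ] V) : Prop where
  mul_assoc : ∀ x y z, O.mul (O.mul x y) z = O.mul x (O.mul y z)
  one_mul : ∀ x, O.mul O.one x = x
  mul_one : ∀ x, O.mul x O.one = x
  coassoc : TensorProduct.assoc ℝ V V V ∘ₗ O.comul.rTensor V ∘ₗ O.comul =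
    O.comul.lTensor V ∘ₗ O.comul
  rTensor_counit : O.counit.rTensor V ∘ₗ O.comul = TensorProduct.mk ℝ _ _ 1
  lTensor_counit : O.counit.lTensor V ∘ₗ O.comul = (TensorProduct.mk ℝ _ _).flip 1
  counit_one : O.counit O.one = 1
  counit_mul : ∀ x y, O.counit (O.mul x y) = O.counit x * O.counit y
  comul_one : O.comul O.one = O.one ⊗ₜ O.one
  comul_mul : ∀ x y, O.comul (O.mul x y) =
    TensorProduct.map₂ O.mul O.mul (O.comul x) (O.comul y)
  antipode_left : ∀ x, TensorProduct.lift O.mul (S.rTensor V (O.comul x)) = O.counit x • O.one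
  antipode_right : ∀ x, TensorProduct.lift O.mul (S.lTensor V (O.comul x)) = O.counit x • O.one

/-- Operations that satisfy the Hopf algebra axioms turn the vector space itself into a Hopf
algebra. -/
def IsHopf.asHopfAlgebra {O : HopfOps V} {S : V →ₗ[ℝ] V} (h : O.IsHopf S) : O.AsHopfAlgebra :=
  letI ring : Ring V :=
    { (inferInstance : AddCommGroup V) with
      mul := fun x y => O.mul x y
      one := O.one
      mul_assoc := h.mul_assoc
      one_mul := h.one_mul
      mul_one := h.mul_one
      left_distrib := fun x y z => map_add (O.mul x) y z
      right_distrib := fun x y z => LinearMap.map_add₂ O.mul x y z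
      zero_mul := fun x => LinearMap.map_zero₂ O.mul x
      mul_zero := fun x => map_zero (O.mul x) }
  letI alg : Algebra ℝ V := Algebra.ofModule
    (fun r x y => LinearMap.map_smul₂ O.mul r x y) (fun r x y => map_smul (O.mul x) r y)
  letI coalg : Coalgebra ℝ V :=
    { comul := O.comul
      counit := O.counit
      coassoc := h.coassoc
      rTensor_counit_comp_comul := h.rTensor_counit
      lTensor_counit_comp_comul := h.lTensor_counit }
  letI bialg : Bialgebra ℝ V := Bialgebra.mk' ℝ V h.counit_one (h.counit_mul _ _) h.comul_one
    (fun {a b} => (h.comul_mul a b).trans (tensor_mul_eq_map₂ (O.comul a) (O.comul b)).symm)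
  { carrier := V
    ring := ring
    hopf :=
      { bialg with
        antipode := S
        mul_antipode_rTensor_comul := by
          ext x
          refine (h.antipode_left x).trans ?_
          exact (Algebra.algebraMap_eq_smul_one (R := ℝ) (A := V) _).symm
        mul_antipode_lTensor_comul := by
          ext x
          refine (h.antipode_right x).trans ?_
          exact (Algebra.algebraMap_eq_smul_one (R := ℝ) (A := V) _).symm }
    equiv := LinearEquiv.refl ℝ V
    map_mul := fun _ _ => rfl
    map_one := rfl
    map_comul := fun x => by
      change O.comul x = TensorProduct.map LinearMap.id LinearMap.id (O.comul x)
      simp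
    map_counit := fun _ => rfl }

/-- The linear map `φ` is compatible with products, units, coproducts and counits. -/
structure Intertwines (O₁ : HopfOps V) (O₂ : HopfOps W) (φ : V →ₗ[ℝ] W) : Prop where
  map_mul : ∀ x y, φ (O₁.mul x y) = O₂.mul (φ x) (φ y)
  map_one : φ O₁.one = O₂.one
  map_comul : ∀ x, O₂.comul (φ x) = TensorProduct.map φ φ (O₁.comul x)
  map_counit : ∀ x, O₂.counit (φ x) = O₁.counit x

/-- Transport of a Hopf algebra structure along a compatible linear isomorphism: the same carrier
serves for the operations on the other side. -/
def AsHopfAlgebra.transport {O₁ : HopfOps V} {O₂ : HopfOps W} (H : O₁.AsHopfAlgebra)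
    (φ : V ≃ₗ[ℝ] W) (hφ : O₁.Intertwines O₂ φ.toLinearMap) : O₂.AsHopfAlgebra where
  carrier := H.carrier
  equiv := φ.symm.trans H.equiv
  map_mul x y := by
    have h := hφ.map_mul (φ.symm x) (φ.symm y)
    simp only [LinearEquiv.coe_coe, LinearEquiv.apply_symm_apply] at h
    simp [← h, H.map_mul]
  map_one := by
    have h := hφ.map_one
    simp only [LinearEquiv.coe_coe] at h
    simp [← h, H.map_one]
  map_comul x := by
    have h := hφ.map_comul (φ.symm x)
    simp only [LinearEquiv.coe_coe, LinearEquiv.apply_symm_apply] at h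
    have he : (φ.symm.trans H.equiv).toLinearMap ∘ₗ φ.toLinearMap = H.equiv.toLinearMap := by
      ext; simp
    rw [h, LinearEquiv.trans_apply, H.map_comul,
      ← LinearMap.comp_apply (TensorProduct.map (φ.symm.trans H.equiv).toLinearMap _),
      ← TensorProduct.map_comp, he]
  map_counit x := by
    have h := hφ.map_counit (φ.symm x)
    simp only [LinearEquiv.coe_coe, LinearEquiv.apply_symm_apply] at h
    rw [h, LinearEquiv.trans_apply, H.map_counit]

/-- A compatible linear bijection out of a Hopf algebra is an isomorphism of Hopf algebras. -/
theorem Intertwines.isHopfIso {O₁ : HopfOps V} {O₂ : HopfOps W} (H : O₁.AsHopfAlgebra)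
    {φ : V →ₗ[ℝ] W} (hφ : O₁.Intertwines O₂ φ) (hb : Function.Bijective φ) :
    IsHopfIso O₁ O₂ φ := by
  let e : V ≃ₗ[ℝ] W := LinearEquiv.ofBijective φ hb
  refine ⟨H, H.transport e hφ, BialgEquiv.refl ℝ H.carrier, fun _ => rfl, fun x => ?_⟩
  change H.equiv x = H.equiv (e.symm (e x))
  rw [LinearEquiv.symm_apply_apply]

/-- A map is compatible as soon as its composition with a compatible surjection is. -/
theorem Intertwines.of_comp {U : Type} [AddCommGroup U] [Module ℝ U] {O₁ : HopfOps V}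
    {O₂ : HopfOps W} {O₃ : HopfOps U} {φ : V →ₗ[ℝ] W} {ψ : W →ₗ[ℝ] U} (hφ : O₁.Intertwines O₂ φ)
    (hs : Function.Surjective φ) (h : O₁.Intertwines O₃ (ψ ∘ₗ φ)) : O₂.Intertwines O₃ ψ where
  map_mul x y := by
    obtain ⟨x, rfl⟩ := hs x
    obtain ⟨y, rfl⟩ := hs y
    rw [← hφ.map_mul]
    exact h.map_mul x y
  map_one := by
    rw [← hφ.map_one]
    exact h.map_one
  map_comul x := by
    obtain ⟨x, rfl⟩ := hs x
    rw [hφ.map_comul, ← LinearMap.comp_apply (TensorProduct.map ψ ψ), ← TensorProduct.map_comp]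
    exact h.map_comul x
  map_counit x := by
    obtain ⟨x, rfl⟩ := hs x
    rw [hφ.map_counit]
    exact h.map_counit x

end HopfOps

section Coalgebra

variable {V W : Type} [AddCommGroup V] [Module ℝ V] [AddCommGroup W] [Module ℝ W]

/-- Coassociativity can be tested after a compatible linear isomorphism. -/
theorem coassoc_of_linearEquiv {δ : V →ₗ[ℝ] V ⊗[ℝ] V} {δ' : W →ₗ[ℝ] W ⊗[ℝ] W} (φ : V ≃ₗ[ℝ] W)
    (h : ∀ x, δ' (φ x) = TensorProduct.map φ.toLinearMap φ.toLinearMap (δ x))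
    (hδ' : TensorProduct.assoc ℝ W W W ∘ₗ δ'.rTensor W ∘ₗ δ' = δ'.lTensor W ∘ₗ δ') :
    TensorProduct.assoc ℝ V V V ∘ₗ δ.rTensor V ∘ₗ δ = δ.lTensor V ∘ₗ δ := by
  have hr : ∀ t : V ⊗[ℝ] V, δ'.rTensor W (TensorProduct.map φ.toLinearMap φ.toLinearMap t) =
      TensorProduct.map (TensorProduct.map φ.toLinearMap φ.toLinearMap) φ.toLinearMap
        (δ.rTensor V t) := by
    intro t
    induction t with
    | zero => simp
    | add s t hs ht => simp only [map_add, hs, ht]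
    | tmul a b => simp [h]
  have hl : ∀ t : V ⊗[ℝ] V, δ'.lTensor W (TensorProduct.map φ.toLinearMap φ.toLinearMap t) =
      TensorProduct.map φ.toLinearMap (TensorProduct.map φ.toLinearMap φ.toLinearMap)
        (δ.lTensor V t) := by
    intro t
    induction t with
    | zero => simp
    | add s t hs ht => simp only [map_add, hs, ht]
    | tmul a b => simp [h]
  have ha : ∀ t : (V ⊗[ℝ] V) ⊗[ℝ] V, TensorProduct.assoc ℝ W W W
      (TensorProduct.map (TensorProduct.map φ.toLinearMap φ.toLinearMap) φ.toLinearMap t) =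
      TensorProduct.map φ.toLinearMap (TensorProduct.map φ.toLinearMap φ.toLinearMap)
        (TensorProduct.assoc ℝ V V V t) := fun t => by
    rw [TensorProduct.map_map_assoc]
  ext x
  apply (TensorProduct.congr φ (TensorProduct.congr φ φ)).injective
  have := LinearMap.congr_fun hδ' (φ x)
  simp only [LinearMap.comp_apply, h, hr, hl, LinearEquiv.coe_coe, ha] at this
  exact this

/-- Left counitality can be tested after a compatible linear isomorphism. -/
theorem rTensor_counit_of_linearEquiv {δ : V →ₗ[ℝ] V ⊗[ℝ] V} {δ' : W →ₗ[ℝ] W ⊗[ℝ] W}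
    {ε : V →ₗ[ℝ] ℝ} {ε' : W →ₗ[ℝ] ℝ} (φ : V ≃ₗ[ℝ] W)
    (h : ∀ x, δ' (φ x) = TensorProduct.map φ.toLinearMap φ.toLinearMap (δ x))
    (hε : ∀ x, ε' (φ x) = ε x) (hδ' : ε'.rTensor W ∘ₗ δ' = TensorProduct.mk ℝ _ _ 1) :
    ε.rTensor V ∘ₗ δ = TensorProduct.mk ℝ _ _ 1 := by
  have hr : ∀ t : V ⊗[ℝ] V, ε'.rTensor W (TensorProduct.map φ.toLinearMap φ.toLinearMap t) =
      φ.toLinearMap.lTensor ℝ (ε.rTensor V t) := by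
    intro t
    induction t with
    | zero => simp
    | add s t hs ht => simp only [map_add, hs, ht]
    | tmul a b => simp [hε]
  ext x
  apply (φ.lTensor ℝ).injective
  have := LinearMap.congr_fun hδ' (φ x)
  simp only [LinearMap.comp_apply, h, hr] at this
  exact this.trans (by simp)

/-- Right counitality can be tested after a compatible linear isomorphism. -/
theorem lTensor_counit_of_linearEquiv {δ : V →ₗ[ℝ] V ⊗[ℝ] V} {δ' : W →ₗ[ℝ] W ⊗[ℝ] W}
    {ε : V →ₗ[ℝ] ℝ} {ε' : W →ₗ[ℝ] ℝ} (φ : V ≃ₗ[ℝ] W)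
    (h : ∀ x, δ' (φ x) = TensorProduct.map φ.toLinearMap φ.toLinearMap (δ x))
    (hε : ∀ x, ε' (φ x) = ε x) (hδ' : ε'.lTensor W ∘ₗ δ' = (TensorProduct.mk ℝ _ _).flip 1) :
    ε.lTensor V ∘ₗ δ = (TensorProduct.mk ℝ _ _).flip 1 := by
  have hl : ∀ t : V ⊗[ℝ] V, ε'.lTensor W (TensorProduct.map φ.toLinearMap φ.toLinearMap t) =
      φ.toLinearMap.rTensor ℝ (ε.lTensor V t) := by
    intro t
    induction t with
    | zero => simp
    | add s t hs ht => simp only [map_add, hs, ht]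
    | tmul a b => simp [hε]
  ext x
  apply (φ.rTensor ℝ).injective
  have := LinearMap.congr_fun hδ' (φ x)
  simp only [LinearMap.comp_apply, h, hl] at this
  exact this.trans (by simp)

end Coalgebra

/-! ### Triangular linear maps -/

/-- A linear endomorphism of a space of finitely supported functions is bijective if it is
triangular with nonzero diagonal with respect to a well-founded rank. -/
theorem bijective_of_triangular {α β : Type} [LinearOrder β] [WellFoundedLT β] (rank : α → β)
    (T : (α →₀ ℝ) →ₗ[ℝ] (α →₀ ℝ)) (hd : ∀ a, T (Finsupp.single a 1) a ≠ 0)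
    (hT : ∀ a b, T (Finsupp.single a 1) b ≠ 0 → b ≠ a → rank b < rank a) :
    Function.Bijective T := by
  classical
  constructor
  · rw [injective_iff_map_eq_zero]
    intro x hx
    by_contra hne
    -- The coefficient of `T x` at an element `a` of maximal rank in the support of `x` is the
    -- diagonal one.
    obtain ⟨a, ha, hmax⟩ := x.support.exists_max_image rank (Finsupp.support_nonempty_iff.2 hne)
    have h1 : T x a = ∑ b ∈ x.support, x b * T (Finsupp.single b 1) a := by
      conv_lhs => rw [← Finsupp.sum_single x]
      rw [Finsupp.sum, map_sum, Finsupp.finsetSum_apply]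
      refine Finset.sum_congr rfl fun b _ => ?_
      rw [← mul_one (x b), ← smul_eq_mul, ← Finsupp.smul_single, map_smul]
      simp
    rw [Finset.sum_eq_single a, hx] at h1
    · exact mul_ne_zero (Finsupp.mem_support_iff.1 ha) (hd a) h1.symm
    · intro b hb hba
      by_contra h
      exact (hT b a (right_ne_zero_of_mul h) hba.symm).not_ge (hmax b hb)
    · exact fun h => (h ha).elim
  · -- By induction on the rank every basis vector is in the range: up to a nonzero factor it is
    -- its own image minus a combination of basis vectors of smaller rank.
    have key : ∀ r : β, ∀ a, rank a = r → Finsupp.single a (1 : ℝ) ∈ LinearMap.range T := by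
      intro r
      induction r using WellFoundedLT.induction with
      | ind r ih =>
      rintro a rfl
      have hrest : (T (Finsupp.single a 1)).erase a ∈ LinearMap.range T := by
        rw [← Finsupp.sum_single ((T (Finsupp.single a 1)).erase a)]
        refine Submodule.sum_mem _ fun b hb => ?_
        rw [← mul_one (((T (Finsupp.single a 1)).erase a) b), ← smul_eq_mul,
          ← Finsupp.smul_single]
        rw [Finsupp.support_erase, Finset.mem_erase, Finsupp.mem_support_iff] at hb
        exact Submodule.smul_mem _ _ (ih _ (hT a b hb.2 hb.1) b rfl)
      have hsplit := Finsupp.single_add_erase a (T (Finsupp.single a 1))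
      have hs : Finsupp.single a (T (Finsupp.single a 1) a) ∈ LinearMap.range T := by
        rw [eq_sub_of_add_eq hsplit]
        exact Submodule.sub_mem _ ⟨_, rfl⟩ hrest
      have := Submodule.smul_mem _ (T (Finsupp.single a 1) a)⁻¹ hs
      rwa [Finsupp.smul_single, smul_eq_mul, inv_mul_cancel₀ (hd a)] at this
    intro x
    change x ∈ LinearMap.range T
    rw [← Finsupp.sum_single x]
    refine Submodule.sum_mem _ fun a _ => ?_
    rw [← mul_one (x a), ← smul_eq_mul, ← Finsupp.smul_single]
    exact Submodule.smul_mem _ _ (key _ a rfl)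

/-! ### Homomorphisms that are surjective on vertices or edges -/

section Counting

variable {V W X Y : Type} {G : SimpleGraph V} {H : SimpleGraph W}

instance finite_hom [Finite V] [Finite W] : Finite (G →g H) :=
  Finite.of_injective (fun f => (f : V → W)) DFunLike.coe_injective

/-- Every edge of the target is the image of an edge of the source. -/
def EdgeSurjective (f : G →g H) : Prop :=
  ∀ ⦃w w'⦄, H.Adj w w' → ∃ v v', G.Adj v v' ∧ f v = w ∧ f v' = w'

theorem edgeSurjective_iff (f : G →g H) :
    EdgeSurjective f ↔ Function.Surjective f.mapEdgeSet := by
  constructor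
  · rintro h ⟨e, he⟩
    induction e using Sym2.ind with
    | h w w' =>
      obtain ⟨v, v', hv, rfl, rfl⟩ := h he
      exact ⟨⟨s(v, v'), hv⟩, rfl⟩
  · intro h w w' hw
    obtain ⟨⟨e, he⟩, hew⟩ := h ⟨s(w, w'), hw⟩
    induction e using Sym2.ind with
    | h v v' =>
      have hs : s(f v, f v') = s(w, w') := congrArg Subtype.val hew
      rcases Sym2.eq_iff.1 hs with ⟨h1, h2⟩ | ⟨h1, h2⟩
      · exact ⟨v, v', he, h1, h2⟩
      · exact ⟨v', v, SimpleGraph.Adj.symm he, h2, h1⟩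

/-- The homomorphisms that are surjective on vertices and, if `r` holds, also on edges.  The
proposition `r` allows to treat epimorphisms and regular epimorphisms at once. -/
def surjHoms (r : Prop) (G : SimpleGraph V) (H : SimpleGraph W) : Set (G →g H) :=
  {f | Function.Surjective f ∧ (r → EdgeSurjective f)}

/-- The number of homomorphisms that are surjective on vertices and, if `r` holds, also on
edges. -/
def surjCount (r : Prop) (G : SimpleGraph V) (H : SimpleGraph W) : ℕ := Nat.card (surjHoms r G H)

theorem comp_iso_mem_surjHoms {r : Prop} {G' : SimpleGraph X} {H' : SimpleGraph Y} (e : G' ≃g G)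
    (e' : H ≃g H') {f : G →g H} (hf : f ∈ surjHoms r G H) :
    (e'.toHom.comp f).comp e.toHom ∈ surjHoms r G' H' := by
  refine ⟨(e'.surjective.comp hf.1).comp e.surjective, fun hr w w' hw => ?_⟩
  obtain ⟨v, v', hv, h1, h2⟩ := hf.2 hr (e'.symm.map_rel_iff.2 hw)
  refine ⟨e.symm v, e.symm v', e.symm.map_rel_iff.2 hv, ?_, ?_⟩
  · change e' (f (e (e.symm v))) = w
    simp [h1]
  · change e' (f (e (e.symm v'))) = w'
    simp [h2]

theorem surjCount_congr (r : Prop) {G' : SimpleGraph X} {H' : SimpleGraph Y} (e : G ≃g G')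
    (e' : H ≃g H') : surjCount r G H = surjCount r G' H' := by
  refine Nat.card_congr
    { toFun := fun f => ⟨_, comp_iso_mem_surjHoms e.symm e' f.2⟩
      invFun := fun f => ⟨_, comp_iso_mem_surjHoms e e'.symm f.2⟩
      left_inv := fun f => ?_
      right_inv := fun f => ?_ }
  · ext v
    change e'.symm (e' (f.1 (e.symm (e v)))) = f.1 v
    simp
  · ext v
    change e' (e'.symm (f.1 (e (e.symm v)))) = f.1 v
    simp

/-- The image of a graph without isolated vertices has none. -/
theorem NoIsolated.of_mem_surjHoms {r : Prop} (hG : NoIsolated G) {f : G →g H}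
    (hf : f ∈ surjHoms r G H) : NoIsolated H := by
  intro w
  obtain ⟨v, rfl⟩ := hf.1 w
  obtain ⟨u, hu⟩ := hG v
  exact ⟨f u, f.map_adj hu⟩

/-- On targets without isolated vertices, surjectivity on edges implies surjectivity on
vertices. -/
theorem mem_surjHoms_true_iff (hH : NoIsolated H) {f : G →g H} :
    f ∈ surjHoms True G H ↔ Function.Surjective f.mapEdgeSet := by
  rw [← edgeSurjective_iff]
  refine ⟨fun h => h.2 trivial, fun h => ⟨fun w => ?_, fun _ => h⟩⟩
  obtain ⟨w', hw⟩ := hH w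
  obtain ⟨v, _, _, hv, _⟩ := h hw
  exact ⟨v, hv⟩

/-! ### Homomorphisms onto a disjoint union -/

theorem connectedComponentMk_eq_of_adj {v w : V} (h : G.Adj v w) :
    G.connectedComponentMk v = G.connectedComponentMk w :=
  SimpleGraph.ConnectedComponent.sound h.reachable

theorem apply_eq_of_reachable {f : V → X} (hf : ∀ v w, G.Adj v w → f v = f w) {v w : V}
    (h : G.Reachable v w) : f v = f w := by
  obtain ⟨p⟩ := h
  induction p with
  | nil => rfl
  | cons hadj _ ih => exact (hf _ _ hadj).trans ih

/-- The subgraph formed by the connected components in `S`. -/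
abbrev compInduce (G : SimpleGraph V) (S : Set G.ConnectedComponent) :
    SimpleGraph {v | G.connectedComponentMk v ∈ S} :=
  G.induce {v | G.connectedComponentMk v ∈ S}

open scoped Classical in
/-- Homomorphisms given on the components in `S` and on the others, with values in the two parts
of a disjoint union. -/
def glueHom {H₁ : SimpleGraph X} {H₂ : SimpleGraph Y} (S : Set G.ConnectedComponent)
    (f : compInduce G S →g H₁) (g : compInduce G Sᶜ →g H₂) : G →g H₁ ⊕g H₂ where
  toFun v := if h : G.connectedComponentMk v ∈ S then Sum.inl (f ⟨v, h⟩) else Sum.inr (g ⟨v, h⟩)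
  map_rel' {v w} hvw := by
    have hc := connectedComponentMk_eq_of_adj hvw
    by_cases h : G.connectedComponentMk v ∈ S
    · have h' := h
      rw [hc] at h'
      rw [dif_pos h, dif_pos h', SimpleGraph.sum_adj_inl]
      exact f.map_adj (by exact hvw)
    · have h' := h
      rw [hc] at h'
      rw [dif_neg h, dif_neg h', SimpleGraph.sum_adj_inr]
      exact g.map_adj (by exact hvw)

variable {H₁ : SimpleGraph X} {H₂ : SimpleGraph Y}

theorem glueHom_of_mem {S : Set G.ConnectedComponent} (f : compInduce G S →g H₁)
    (g : compInduce G Sᶜ →g H₂) (v : {v | G.connectedComponentMk v ∈ S}) :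
    glueHom S f g v = Sum.inl (f v) := dif_pos v.2

theorem glueHom_of_not_mem {S : Set G.ConnectedComponent} (f : compInduce G S →g H₁)
    (g : compInduce G Sᶜ →g H₂) (v : {v | G.connectedComponentMk v ∈ Sᶜ}) :
    glueHom S f g v = Sum.inr (g v) := dif_neg v.2

theorem mem_iff_glueHom {S : Set G.ConnectedComponent} (f : compInduce G S →g H₁)
    (g : compInduce G Sᶜ →g H₂) (v : V) :
    G.connectedComponentMk v ∈ S ↔ (glueHom S f g v).isLeft := by
  by_cases h : G.connectedComponentMk v ∈ S
  · simp [h, glueHom_of_mem f g ⟨v, h⟩]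
  · simp [h, glueHom_of_not_mem f g ⟨v, h⟩]

theorem glueHom_mem_surjHoms_iff {r : Prop} {S : Set G.ConnectedComponent}
    (f : compInduce G S →g H₁) (g : compInduce G Sᶜ →g H₂) :
    glueHom S f g ∈ surjHoms r G (H₁ ⊕g H₂) ↔ f ∈ surjHoms r _ H₁ ∧ g ∈ surjHoms r _ H₂ := by
  -- A vertex with image on the left lies in `S`, and similarly on the right.
  have hl : ∀ v x, glueHom S f g v = Sum.inl x →
      ∃ h : G.connectedComponentMk v ∈ S, f ⟨v, h⟩ = x := by
    intro v x hv
    have h : G.connectedComponentMk v ∈ S := (mem_iff_glueHom f g v).2 (by simp [hv])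
    exact ⟨h, Sum.inl.inj ((glueHom_of_mem f g ⟨v, h⟩).symm.trans hv)⟩
  have hr : ∀ v y, glueHom S f g v = Sum.inr y →
      ∃ h : G.connectedComponentMk v ∈ Sᶜ, g ⟨v, h⟩ = y := by
    intro v y hv
    have h : G.connectedComponentMk v ∉ S := fun h => by
      simpa [hv] using (mem_iff_glueHom f g v).1 h
    exact ⟨h, Sum.inr.inj ((glueHom_of_not_mem f g ⟨v, h⟩).symm.trans hv)⟩
  constructor
  · rintro ⟨h1, h2⟩
    refine ⟨⟨fun x => ?_, fun p w w' hw => ?_⟩, ⟨fun y => ?_, fun p w w' hw => ?_⟩⟩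
    · obtain ⟨v, hv⟩ := h1 (Sum.inl x)
      obtain ⟨h, h'⟩ := hl v x hv
      exact ⟨_, h'⟩
    · obtain ⟨v, v', hadj, hv, hv'⟩ := h2 p (SimpleGraph.sum_adj_inl.2 hw)
      obtain ⟨h, e⟩ := hl v _ hv
      obtain ⟨h', e'⟩ := hl v' _ hv'
      exact ⟨⟨v, h⟩, ⟨v', h'⟩, hadj, e, e'⟩
    · obtain ⟨v, hv⟩ := h1 (Sum.inr y)
      obtain ⟨h, h'⟩ := hr v y hv
      exact ⟨_, h'⟩
    · obtain ⟨v, v', hadj, hv, hv'⟩ := h2 p (SimpleGraph.sum_adj_inr.2 hw)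
      obtain ⟨h, e⟩ := hr v _ hv
      obtain ⟨h', e'⟩ := hr v' _ hv'
      exact ⟨⟨v, h⟩, ⟨v', h'⟩, hadj, e, e'⟩
  · rintro ⟨⟨f1, f2⟩, ⟨g1, g2⟩⟩
    refine ⟨?_, fun p => ?_⟩
    · rintro (x | y)
      · obtain ⟨v, rfl⟩ := f1 x
        exact ⟨v, glueHom_of_mem f g v⟩
      · obtain ⟨v, rfl⟩ := g1 y
        exact ⟨v, glueHom_of_not_mem f g v⟩
    · rintro (w | w) (w' | w') hw
      · obtain ⟨v, v', hadj, rfl, rfl⟩ := f2 p (SimpleGraph.sum_adj_inl.1 hw)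
        exact ⟨v, v', hadj, glueHom_of_mem f g v, glueHom_of_mem f g v'⟩
      · simp at hw
      · simp at hw
      · obtain ⟨v, v', hadj, rfl, rfl⟩ := g2 p (SimpleGraph.sum_adj_inr.1 hw)
        exact ⟨v, v', hadj, glueHom_of_not_mem f g v, glueHom_of_not_mem f g v'⟩

/-- Every homomorphism to a disjoint union is obtained by glueing. -/
theorem exists_glueHom_eq (h : G →g H₁ ⊕g H₂) : ∃ S, ∃ f : compInduce G S →g H₁,
    ∃ g : compInduce G Sᶜ →g H₂, glueHom S f g = h := by
  have hadj : ∀ v w, G.Adj v w → (h v).isLeft = (h w).isLeft := by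
    intro v w hvw
    have h' := h.map_adj hvw
    rcases hv : h v with x | x <;> rcases hw : h w with y | y <;> simp_all
  let S : Set G.ConnectedComponent := {c | ∃ v, G.connectedComponentMk v = c ∧ (h v).isLeft}
  have hS : ∀ v, G.connectedComponentMk v ∈ S ↔ (h v).isLeft := by
    intro v
    refine ⟨?_, fun hv => ⟨v, rfl, hv⟩⟩
    rintro ⟨w, hw, hl⟩
    rwa [← apply_eq_of_reachable hadj (SimpleGraph.ConnectedComponent.exact hw)]
  have hS' : ∀ v, G.connectedComponentMk v ∈ Sᶜ → (h v).isRight := by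
    intro v hv
    have := (hS v).not.1 hv
    simpa using this
  have hf : ∀ v : {v | G.connectedComponentMk v ∈ S},
      h v = Sum.inl ((h v).getLeft ((hS v).1 v.2)) := fun v => by simp
  have hg : ∀ v : {v | G.connectedComponentMk v ∈ Sᶜ},
      h v = Sum.inr ((h v).getRight (hS' v v.2)) := fun v => by simp
  refine ⟨S, ⟨fun v => (h v).getLeft ((hS v).1 v.2), fun {v w} hvw => ?_⟩,
    ⟨fun v => (h v).getRight (hS' v v.2), fun {v w} hvw => ?_⟩, ?_⟩
  · have h' := h.map_adj (SimpleGraph.induce_adj.1 hvw)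
    rw [hf v, hf w] at h'
    exact SimpleGraph.sum_adj_inl.1 h'
  · have h' := h.map_adj (SimpleGraph.induce_adj.1 hvw)
    rw [hg v, hg w] at h'
    exact SimpleGraph.sum_adj_inr.1 h'
  · ext v
    by_cases hv : v ∈ {v | G.connectedComponentMk v ∈ S}
    · exact (glueHom_of_mem _ _ ⟨v, hv⟩).trans (hf ⟨v, hv⟩).symm
    · exact (glueHom_of_not_mem _ _ ⟨v, hv⟩).trans (hg ⟨v, hv⟩).symm

open scoped Classical in
/-- A surjection onto a disjoint union splits the components of the source into two sets, each
of which is mapped onto one of the two parts. -/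
theorem surjCount_sum_right [Finite V] [Finite X] [Finite Y] [Fintype G.ConnectedComponent]
    (r : Prop) : surjCount r G (H₁ ⊕g H₂) = ∑ S : Set G.ConnectedComponent,
      surjCount r (compInduce G S) H₁ * surjCount r (compInduce G Sᶜ) H₂ := by
  let F : (Σ S : Set G.ConnectedComponent,
      surjHoms r (compInduce G S) H₁ × surjHoms r (compInduce G Sᶜ) H₂) →
      surjHoms r G (H₁ ⊕g H₂) := fun p =>
    ⟨glueHom p.1 p.2.1.1 p.2.2.1, (glueHom_mem_surjHoms_iff _ _).2 ⟨p.2.1.2, p.2.2.2⟩⟩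
  have hF : Function.Bijective F := by
    constructor
    · rintro ⟨S, ⟨f, hf⟩, ⟨g, hg⟩⟩ ⟨S', ⟨f', hf'⟩, ⟨g', hg'⟩⟩ h
      have h : glueHom S f g = glueHom S' f' g' := congrArg Subtype.val h
      obtain rfl : S = S' := by
        ext c
        induction c using SimpleGraph.ConnectedComponent.ind with
        | h v => rw [mem_iff_glueHom f g, mem_iff_glueHom f' g', h]
      obtain rfl : f = f' := by
        ext v
        apply Sum.inl_injective (β := Y)
        rw [← glueHom_of_mem f g, ← glueHom_of_mem f' g', h]
      obtain rfl : g = g' := by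
        ext v
        apply Sum.inr_injective (α := X)
        rw [← glueHom_of_not_mem f g, ← glueHom_of_not_mem f g', h]
      rfl
    · rintro ⟨h, hh⟩
      obtain ⟨S, f, g, rfl⟩ := exists_glueHom_eq h
      rw [glueHom_mem_surjHoms_iff] at hh
      exact ⟨⟨S, ⟨f, hh.1⟩, ⟨g, hh.2⟩⟩, rfl⟩
  rw [surjCount, ← Nat.card_congr (Equiv.ofBijective F hF), Nat.card_sigma]
  simp only [Nat.card_prod]
  rfl

/-! ### Homomorphisms out of a disjoint union -/

open scoped Classical in
/-- Counting pairs whose images under two set-valued maps cover the whole set. -/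
theorem card_cover {A B E : Type} [Finite A] [Finite B] [Fintype E] (a : A → Set E)
    (b : B → Set E) : Nat.card {p : A × B // (a p.1)ᶜ ⊆ b p.2} =
      ∑ p : Set E × Set E with p.1ᶜ ⊆ p.2,
        Nat.card {x // a x = p.1} * Nat.card {y // b y = p.2} := by
  cases nonempty_fintype A
  cases nonempty_fintype B
  simp only [Nat.card_eq_fintype_card, Fintype.card_subtype]
  rw [Finset.card_eq_sum_card_fiberwise (f := fun p : A × B => (a p.1, b p.2))
    (t := Finset.univ.filter fun p : Set E × Set E => p.1ᶜ ⊆ p.2)]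
  · refine Finset.sum_congr rfl fun p hp => ?_
    rw [← Finset.card_product]
    congr 1
    ext ⟨x, y⟩
    simp only [Finset.mem_filter, Finset.mem_univ, true_and, Finset.mem_product] at hp ⊢
    constructor
    · rintro ⟨-, rfl⟩
      exact ⟨rfl, rfl⟩
    · rintro ⟨h1, h2⟩
      exact ⟨by rwa [h1, h2], by rw [h1, h2]⟩
  · intro p hp
    simpa using hp

/-- Homomorphisms out of a disjoint union are pairs of homomorphisms. -/
def sumHomEquiv (G₁ : SimpleGraph V) (G₂ : SimpleGraph W) (H : SimpleGraph X) :
    (G₁ ⊕g G₂ →g H) ≃ (G₁ →g H) × (G₂ →g H) where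
  toFun f := (f.comp SimpleGraph.Embedding.sumInl.toHom, f.comp SimpleGraph.Embedding.sumInr.toHom)
  invFun p := ⟨Sum.elim p.1 p.2, by
    rintro (v | v) (w | w) h
    · exact p.1.map_adj (SimpleGraph.sum_adj_inl.1 h)
    · simp at h
    · simp at h
    · exact p.2.map_adj (SimpleGraph.sum_adj_inr.1 h)⟩
  left_inv f := by ext (v | v) <;> rfl
  right_inv p := rfl

/-- The surjections onto an induced subgraph are the homomorphisms with a given vertex image. -/
theorem surjCount_induce (U : Set W) :
    surjCount False G (H.induce U) = Nat.card {f : G →g H // Set.range f = U} := by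
  refine Nat.card_congr
    { toFun := fun f => ⟨(SimpleGraph.Embedding.induce U).toHom.comp f.1, ?_⟩
      invFun := fun f => ⟨⟨fun v => ⟨f.1 v, f.2.subset (Set.mem_range_self v)⟩,
        fun {_ _} h => f.1.map_adj h⟩, fun w => ?_, False.elim⟩
      left_inv := fun f => rfl
      right_inv := fun f => rfl }
  · ext w
    constructor
    · rintro ⟨v, rfl⟩
      exact (f.1 v).2
    · intro hw
      obtain ⟨v, hv⟩ := f.2.1 ⟨w, hw⟩
      exact ⟨v, congrArg Subtype.val hv⟩
  · obtain ⟨v, hv⟩ : (w : W) ∈ Set.range f.1 := f.2.symm ▸ w.2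
    exact ⟨v, Subtype.ext hv⟩

open scoped Classical in
/-- The vertex images of the two parts of a surjection out of a disjoint union cover the
vertices of the target. -/
theorem surjCount_false_sum_left [Finite V] [Finite W] [Fintype X] (G₁ : SimpleGraph V)
    (G₂ : SimpleGraph W) (H : SimpleGraph X) : surjCount False (G₁ ⊕g G₂) H =
      ∑ p : Set X × Set X with p.1ᶜ ⊆ p.2,
        surjCount False G₁ (H.induce p.1) * surjCount False G₂ (H.induce p.2) := by
  simp only [surjCount_induce]
  rw [← card_cover (fun f : G₁ →g H => Set.range f) (fun f : G₂ →g H => Set.range f)]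
  refine Nat.card_congr ((sumHomEquiv G₁ G₂ H).subtypeEquiv fun f => ?_)
  have hr : Set.range f = Set.range (f ∘ Sum.inl) ∪ Set.range (f ∘ Sum.inr) := by
    rw [← Set.Sum.elim_range, Sum.elim_comp_inl_inr]
  have h : f ∈ surjHoms False (G₁ ⊕g G₂) H ↔ Set.range f = Set.univ :=
    ⟨fun h => h.1.range_eq, fun h => ⟨Set.range_eq_univ.1 h, False.elim⟩⟩
  rw [h, hr, Set.compl_subset_iff_union]
  rfl

/-- The surjections on edges onto a restricted graph are the homomorphisms with a given edge
image. -/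
theorem surjCount_restrictGraph (hG : NoIsolated G) (γ : FinGraphNo) (A : Set γ.graph.edgeSet) :
    surjCount True G (γ.restrictGraph A) =
      Nat.card {f : G →g γ.graph // Set.range f.mapEdgeSet = A} := by
  have hval : ∀ x y : γ.support A, (γ.restrictGraph A).Adj x y →
      ∃ h : γ.graph.Adj x y, (⟨s(x.1, y.1), h⟩ : γ.graph.edgeSet) ∈ A := by
    rintro x y ⟨⟨b, hb, he⟩, -⟩
    have hadj : γ.graph.Adj x y := by
      have := b.2
      rwa [he] at this
    exact ⟨hadj, (Subtype.ext he : b = ⟨s(x.1, y.1), hadj⟩) ▸ hb⟩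
  have hadj : ∀ x y : γ.support A, ∀ h : γ.graph.Adj x y,
      (⟨s(x.1, y.1), h⟩ : γ.graph.edgeSet) ∈ A → (γ.restrictGraph A).Adj x y :=
    fun x y h hA => ⟨⟨_, hA, rfl⟩, h.ne⟩
  have hmem : ∀ f : {f : G →g γ.graph // Set.range f.mapEdgeSet = A}, ∀ v w, ∀ h : G.Adj v w,
      (⟨s(f.1 v, f.1 w), f.1.map_adj h⟩ : γ.graph.edgeSet) ∈ A := fun f v w h =>
    f.2.subset ⟨⟨s(v, w), h⟩, rfl⟩
  refine Nat.card_congr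
    { toFun := fun f => ⟨⟨fun v => (f.1 v).1, fun {v w} h => (hval _ _ (f.1.map_adj h)).1⟩, ?_⟩
      invFun := fun f => ⟨⟨fun v => ⟨f.1 v, ?_⟩, fun {v w} h => hadj _ _ _ (hmem f v w h)⟩, ?_⟩
      left_inv := fun f => rfl
      right_inv := fun f => rfl }
  · ext ⟨e, he⟩
    constructor
    · rintro ⟨⟨e', he'⟩, h⟩
      rw [← h]
      induction e' using Sym2.ind with
      | h v w => exact (hval _ _ (f.1.map_adj he')).2
    · intro hA
      induction e using Sym2.ind with
      | h x y =>
        have hx : x ∈ γ.support A := ⟨_, hA, Sym2.mem_mk_left x y⟩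
        have hy : y ∈ γ.support A := ⟨_, hA, Sym2.mem_mk_right x y⟩
        obtain ⟨v, w, hvw, h1, h2⟩ := f.2.2 trivial (hadj ⟨x, hx⟩ ⟨y, hy⟩ he hA)
        refine ⟨⟨s(v, w), hvw⟩, Subtype.ext ?_⟩
        change s((f.1 v).1, (f.1 w).1) = s(x, y)
        rw [h1, h2]
  · obtain ⟨w, hw⟩ := hG v
    exact ⟨_, hmem f v w hw, Sym2.mem_mk_left _ _⟩
  · rw [mem_surjHoms_true_iff (γ.noIsolated_restrictGraph A), ← edgeSurjective_iff]
    intro x y hxy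
    obtain ⟨h, hA⟩ := hval x y hxy
    have hs : (⟨s(x.1, y.1), h⟩ : γ.graph.edgeSet) ∈ Set.range f.1.mapEdgeSet := f.2.symm ▸ hA
    obtain ⟨⟨e, he⟩, hxy'⟩ := hs
    induction e using Sym2.ind with
    | h v w =>
      have hs : s(f.1 v, f.1 w) = s(x.1, y.1) := congrArg Subtype.val hxy'
      rcases Sym2.eq_iff.1 hs with ⟨h1, h2⟩ | ⟨h1, h2⟩
      · exact ⟨v, w, he, Subtype.ext h1, Subtype.ext h2⟩
      · exact ⟨w, v, SimpleGraph.Adj.symm he, Subtype.ext h2, Subtype.ext h1⟩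

open scoped Classical in
/-- The edge images of the two parts of a surjection out of a disjoint union cover the edges of
the target. -/
theorem surjCount_true_sum_left [Finite V] [Finite W] {G₁ : SimpleGraph V}
    {G₂ : SimpleGraph W} (h₁ : NoIsolated G₁) (h₂ : NoIsolated G₂) (γ : FinGraphNo) :
    surjCount True (G₁ ⊕g G₂) γ.graph =
      ∑ p : Set γ.graph.edgeSet × Set γ.graph.edgeSet with p.1ᶜ ⊆ p.2,
        surjCount True G₁ (γ.restrictGraph p.1) * surjCount True G₂ (γ.restrictGraph p.2) := by
  simp only [surjCount_restrictGraph h₁, surjCount_restrictGraph h₂]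
  rw [← card_cover (fun f : G₁ →g γ.graph => Set.range f.mapEdgeSet)
    (fun f : G₂ →g γ.graph => Set.range f.mapEdgeSet)]
  refine Nat.card_congr ((sumHomEquiv G₁ G₂ γ.graph).subtypeEquiv fun f => ?_)
  rw [mem_surjHoms_true_iff γ.noIsolated, Set.compl_subset_iff_union, ← Set.range_eq_univ]
  suffices h : Set.range f.mapEdgeSet =
      Set.range (sumHomEquiv G₁ G₂ γ.graph f).1.mapEdgeSet ∪
        Set.range (sumHomEquiv G₁ G₂ γ.graph f).2.mapEdgeSet by rw [h]
  ext e
  constructor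
  · rintro ⟨⟨b, hb⟩, rfl⟩
    induction b using Sym2.ind with
    | h v w =>
      rcases v with v | v <;> rcases w with w | w
      · exact Or.inl ⟨⟨s(v, w), (SimpleGraph.sum_adj_inl (H := G₂)).1 hb⟩, rfl⟩
      · simp at hb
      · simp at hb
      · exact Or.inr ⟨⟨s(v, w), (SimpleGraph.sum_adj_inr (G := G₁)).1 hb⟩, rfl⟩
  · rintro (⟨⟨b, hb⟩, rfl⟩ | ⟨⟨b, hb⟩, rfl⟩)
    · induction b using Sym2.ind with
      | h v w => exact ⟨⟨s(Sum.inl v, Sum.inl w), (SimpleGraph.sum_adj_inl (H := G₂)).2 hb⟩, rfl⟩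
    · induction b using Sym2.ind with
      | h v w => exact ⟨⟨s(Sum.inr v, Sum.inr w), (SimpleGraph.sum_adj_inr (G := G₁)).2 hb⟩, rfl⟩

/-! ### Spanning subgraphs of the target -/

/-- The image of a homomorphism as a graph on all vertices of the target. -/
def imageGraph (f : G →g H) : SimpleGraph W where
  Adj w w' := ∃ v v', G.Adj v v' ∧ f v = w ∧ f v' = w'
  symm := ⟨fun _ _ ⟨v, v', h, h1, h2⟩ => ⟨v', v, h.symm, h2, h1⟩⟩
  loopless := ⟨by
    rintro w ⟨v, v', h, h1, h2⟩
    exact (f.map_adj h).ne (h1.trans h2.symm)⟩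

theorem imageGraph_le (f : G →g H) : imageGraph f ≤ H := by
  rintro _ _ ⟨v, v', h, rfl, rfl⟩
  exact f.map_adj h

/-- The graphs on the same vertex set with fewer edges, as a finite set. -/
def spanningSubgraphs [Finite W] (H : SimpleGraph W) : Finset (SimpleGraph W) :=
  (Set.toFinite {K | K ≤ H}).toFinset

theorem mem_spanningSubgraphs [Finite W] {H K : SimpleGraph W} :
    K ∈ spanningSubgraphs H ↔ K ≤ H := by
  simp [spanningSubgraphs]

/-- A homomorphism that is surjective on vertices is surjective on the edges of a unique spanning
subgraph of the target, its image. -/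
theorem surjCount_false_eq_sum [Finite V] [Finite W] (G : SimpleGraph V) (H : SimpleGraph W) :
    surjCount False G H = ∑ K ∈ spanningSubgraphs H, surjCount True G K := by
  let F : (Σ K : {K // K ∈ spanningSubgraphs H}, surjHoms True G K.1) →
      surjHoms False G H := fun p =>
    ⟨(SimpleGraph.Hom.ofLE (mem_spanningSubgraphs.1 p.1.2)).comp p.2.1, p.2.2.1, False.elim⟩
  have hF : Function.Bijective F := by
    constructor
    · rintro ⟨⟨K, hK⟩, ⟨f, hf⟩⟩ ⟨⟨K', hK'⟩, ⟨f', hf'⟩⟩ h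
      have h : ∀ v, f v = f' v := fun v => DFunLike.congr_fun (congrArg Subtype.val h) v
      obtain rfl : K = K' := by
        ext w w'
        constructor
        · intro hw
          obtain ⟨v, v', hv, rfl, rfl⟩ := hf.2 trivial hw
          rw [h, h]
          exact f'.map_adj hv
        · intro hw
          obtain ⟨v, v', hv, rfl, rfl⟩ := hf'.2 trivial hw
          rw [← h, ← h]
          exact f.map_adj hv
      obtain rfl : f = f' := by
        ext v
        exact h v
      rfl
    · rintro ⟨f, hf⟩
      exact ⟨⟨⟨imageGraph f, mem_spanningSubgraphs.2 (imageGraph_le f)⟩,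
        ⟨⟨f, fun {v v'} h => ⟨v, v', h, rfl, rfl⟩⟩,
        hf.1, fun _ _ _ h => h⟩⟩, rfl⟩
  rw [surjCount, ← Nat.card_congr (Equiv.ofBijective F hF), Nat.card_sigma]
  exact Finset.sum_coe_sort (spanningSubgraphs H) fun K => surjCount True G K

open scoped Classical in
/-- The bijective homomorphisms from `G` to `H`, up to automorphisms of `G`, are the spanning
subgraphs of `H` that are isomorphic to `G`. -/
theorem card_bijective_hom [Finite V] [Finite W] (G : SimpleGraph V) (H : SimpleGraph W) :
    Nat.card {f : G →g H // Function.Bijective f} =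
      ∑ K ∈ spanningSubgraphs H, if Nonempty (G ≃g K) then Nat.card (G ≃g G) else 0 := by
  let F : (Σ K : {K // K ∈ spanningSubgraphs H}, (G ≃g K.1)) →
      {f : G →g H // Function.Bijective f} := fun p =>
    ⟨(SimpleGraph.Hom.ofLE (mem_spanningSubgraphs.1 p.1.2)).comp p.2.toHom, p.2.bijective⟩
  have hF : Function.Bijective F := by
    constructor
    · rintro ⟨⟨K, hK⟩, f⟩ ⟨⟨K', hK'⟩, f'⟩ h
      have h : ∀ v, f v = f' v := fun v => DFunLike.congr_fun (congrArg Subtype.val h) v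
      obtain rfl : K = K' := by
        ext w w'
        obtain ⟨v, rfl⟩ := f.surjective w
        obtain ⟨v', rfl⟩ := f.surjective w'
        rw [f.map_adj_iff, h, h, f'.map_adj_iff]
      obtain rfl : f = f' := by
        ext v
        exact h v
      rfl
    · rintro ⟨f, hf⟩
      refine ⟨⟨⟨imageGraph f, mem_spanningSubgraphs.2 (imageGraph_le f)⟩,
        ⟨Equiv.ofBijective f hf, fun {v v'} => ?_⟩⟩, rfl⟩
      constructor
      · rintro ⟨u, u', h, h1, h2⟩
        rwa [← hf.1 h1, ← hf.1 h2]
      · exact fun h => ⟨v, v', h, rfl, rfl⟩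
  have : ∀ K : {K // K ∈ spanningSubgraphs H}, Finite (G ≃g K.1) := fun K =>
    Finite.of_injective (fun e => (e : V → W)) DFunLike.coe_injective
  rw [← Nat.card_congr (Equiv.ofBijective F hF), Nat.card_sigma,
    ← Finset.sum_coe_sort (spanningSubgraphs H)]
  refine Finset.sum_congr rfl fun K _ => ?_
  split_ifs with h
  · obtain ⟨e⟩ := h
    exact Nat.card_congr
      { toFun := fun f => f.trans e.symm
        invFun := fun f => f.trans e
        left_inv := fun f => by ext v; simp
        right_inv := fun f => by ext v; simp }
  · have := not_nonempty_iff.1 h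
    exact Nat.card_of_isEmpty

end Counting

/-! ### Isomorphism classes of graphs without isolated vertices -/

namespace FinGraphNo

variable {V W : Type} [Finite V] [Finite W] {G : SimpleGraph V} {H : SimpleGraph W}

theorem mk_eq_mk (hG : NoIsolated G) (hH : NoIsolated H) :
    mk G hG = mk H hH ↔ Nonempty (G ≃g H) :=
  Subtype.ext_iff.trans FinGraph.mk_eq_mk

theorem mk_graph (τ : FinGraphNo) : mk τ.graph τ.noIsolated = τ :=
  Subtype.ext (FinGraph.mk_graph τ.1)

theorem mk_graph_iso (hG : NoIsolated G) : Nonempty ((mk G hG).graph ≃g G) :=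
  FinGraph.mk_graph_iso G

theorem eq_iff (σ τ : FinGraphNo) : σ = τ ↔ Nonempty (σ.graph ≃g τ.graph) := by
  rw [← mk_eq_mk σ.noIsolated τ.noIsolated, mk_graph, mk_graph]

theorem empty_eq_mk : empty = mk (⊥ : SimpleGraph (Fin 0))
    (show NoIsolated (⊥ : SimpleGraph (Fin 0)) from fun v => v.elim0) := rfl

theorem eq_empty_iff (τ : FinGraphNo) : τ = empty ↔ τ.order = 0 := by
  constructor
  · rintro rfl
    rw [empty_eq_mk, order_mk]
    simp
  · intro h
    have h1 : IsEmpty (Fin τ.order) := by rw [h]; infer_instance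
    rw [← mk_graph τ, empty_eq_mk, mk_eq_mk]
    exact ⟨⟨Equiv.equivOfIsEmpty _ _, fun {v} => h1.elim v⟩⟩

end FinGraphNo

theorem NoIsolated.sum {V W : Type} {G : SimpleGraph V} {H : SimpleGraph W} (hG : NoIsolated G)
    (hH : NoIsolated H) : NoIsolated (G ⊕g H) := by
  rintro (v | v)
  · obtain ⟨w, hw⟩ := hG v
    exact ⟨Sum.inl w, hw⟩
  · obtain ⟨w, hw⟩ := hH v
    exact ⟨Sum.inr w, hw⟩

theorem NoIsolated.compInduce {V : Type} {G : SimpleGraph V} (hG : NoIsolated G)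
    (S : Set G.ConnectedComponent) : NoIsolated (compInduce G S) := by
  rintro ⟨v, hv⟩
  obtain ⟨w, hw⟩ := hG v
  refine ⟨⟨w, ?_⟩, hw⟩
  change G.connectedComponentMk w ∈ S
  rwa [← connectedComponentMk_eq_of_adj hw]

/-! ### The monoid of graphs under disjoint union -/

namespace FinGraphNo

variable {V W : Type} [Finite V] [Finite W] {G : SimpleGraph V} {H : SimpleGraph W}

theorem mk_disjUnion_mk (hG : NoIsolated G) (hH : NoIsolated H) :
    (mk G hG).disjUnion (mk H hH) = mk (G ⊕g H) (hG.sum hH) := by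
  obtain ⟨e⟩ := mk_graph_iso hG
  obtain ⟨f⟩ := mk_graph_iso hH
  exact (mk_eq_mk _ _).2 ⟨e.sumCongr f⟩

theorem disjUnion_comm (σ τ : FinGraphNo) : σ.disjUnion τ = τ.disjUnion σ :=
  (mk_eq_mk _ _).2 ⟨SimpleGraph.Iso.sumComm⟩

theorem disjUnion_assoc (ρ σ τ : FinGraphNo) :
    (ρ.disjUnion σ).disjUnion τ = ρ.disjUnion (σ.disjUnion τ) := by
  rw [← mk_graph ρ, ← mk_graph σ, ← mk_graph τ]
  simp only [mk_disjUnion_mk]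
  exact (mk_eq_mk _ _).2 ⟨SimpleGraph.Iso.sumAssoc⟩

theorem empty_disjUnion (τ : FinGraphNo) : empty.disjUnion τ = τ := by
  obtain ⟨n, G, hG, rfl⟩ : ∃ n : ℕ, ∃ G : SimpleGraph (Fin n), ∃ hG, mk G hG = τ :=
    ⟨_, _, _, mk_graph τ⟩
  rw [empty_eq_mk, mk_disjUnion_mk, mk_eq_mk]
  refine ⟨⟨Equiv.emptySum _ _, ?_⟩⟩
  rintro (v | v) (w | w)
  · exact v.elim0
  · exact v.elim0
  · exact w.elim0
  · exact SimpleGraph.sum_adj_inr.symm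

theorem disjUnion_empty (τ : FinGraphNo) : τ.disjUnion empty = τ := by
  rw [disjUnion_comm, empty_disjUnion]

theorem disjUnion_eq_empty_iff (σ τ : FinGraphNo) :
    σ.disjUnion τ = empty ↔ σ = empty ∧ τ = empty := by
  simp only [eq_empty_iff, order_disjUnion]
  omega

end FinGraphNo

/-! ### Linear and bilinear maps on the span of graphs -/

@[simp]
theorem linExt_gr {M : Type} [AddCommGroup M] [Module ℝ M] (f : FinGraphNo → M) (τ : FinGraphNo) :
    linExt f (gr τ) = f τ := by
  simp [linExt, gr]

@[simp]
theorem bilinExt_gr (f : FinGraphNo → FinGraphNo → LGraphNo) (σ τ : FinGraphNo) :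
    bilinExt f (gr σ) (gr τ) = f σ τ := by
  simp [bilinExt]

theorem linearMap_ext_gr {M : Type} [AddCommGroup M] [Module ℝ M] {f g : LGraphNo →ₗ[ℝ] M}
    (h : ∀ τ, f (gr τ) = g (gr τ)) : f = g :=
  Finsupp.lhom_ext' fun τ => LinearMap.ext_ring (h τ)

theorem bilin_ext_gr {M : Type} [AddCommGroup M] [Module ℝ M]
    {f g : LGraphNo →ₗ[ℝ] LGraphNo →ₗ[ℝ] M} (h : ∀ σ τ, f (gr σ) (gr τ) = g (gr σ) (gr τ)) :
    f = g :=
  linearMap_ext_gr fun σ => linearMap_ext_gr fun τ => h σ τ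

open scoped Classical in
theorem gr_apply (σ τ : FinGraphNo) : gr σ τ = if σ = τ then 1 else 0 := Finsupp.single_apply

@[simp]
theorem sumGraphs_apply (c : FinGraphNo → ℝ) (N : ℕ) (hc : ∀ γ, c γ ≠ 0 → γ.order ≤ N)
    (γ : FinGraphNo) : sumGraphs c N hc γ = c γ := rfl

@[simp]
theorem mulDisj_gr (σ τ : FinGraphNo) : mulDisj (gr σ) (gr τ) = gr (σ.disjUnion τ) :=
  bilinExt_gr _ _ _

theorem mem_splittings (τ : FinGraphNo) (p : FinGraphNo × FinGraphNo) :
    p ∈ (finite_disjUnion_eq τ).toFinset ↔ p.1.disjUnion p.2 = τ :=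
  Set.Finite.mem_toFinset _

theorem comulDisj_gr (τ : FinGraphNo) :
    comulDisj (gr τ) = ∑ p ∈ (finite_disjUnion_eq τ).toFinset, gr p.1 ⊗ₜ[ℝ] gr p.2 :=
  linExt_gr _ _

/-- The counit is the coefficient of the empty graph. -/
theorem counitGraph_apply (x : LGraphNo) : counitGraph x = x FinGraphNo.empty := by
  classical
  suffices h : counitGraph = Finsupp.lapply FinGraphNo.empty by rw [h]; rfl
  refine linearMap_ext_gr fun τ => ?_
  rw [counitGraph, linExt_gr, Finsupp.lapply_apply, gr_apply]

open scoped Classical in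
theorem counitGraph_gr (τ : FinGraphNo) :
    counitGraph (gr τ) = if τ = FinGraphNo.empty then 1 else 0 := by
  rw [counitGraph_apply, gr_apply]

/-- The coefficient of a basis tensor, as a linear form. -/
def tensorCoeffLin {α : Type} (σ τ : α) : (α →₀ ℝ) ⊗[ℝ] (α →₀ ℝ) →ₗ[ℝ] ℝ :=
  Finsupp.lapply (σ, τ) ∘ₗ (finsuppTensorFinsupp' ℝ α α).toLinearMap

theorem tensorCoeffLin_apply {α : Type} (σ τ : α) (x : (α →₀ ℝ) ⊗[ℝ] (α →₀ ℝ)) :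
    tensorCoeffLin σ τ x = tensorCoeff σ τ x := rfl

@[simp]
theorem tensorCoeffLin_tmul {α : Type} (σ τ : α) (x y : α →₀ ℝ) :
    tensorCoeffLin σ τ (x ⊗ₜ y) = x σ * y τ := by
  simp [tensorCoeffLin]

theorem tensor_ext {α : Type} {x y : (α →₀ ℝ) ⊗[ℝ] (α →₀ ℝ)}
    (h : ∀ σ τ, tensorCoeffLin σ τ x = tensorCoeffLin σ τ y) : x = y := by
  apply (finsuppTensorFinsupp' ℝ α α).injective
  ext ⟨σ, τ⟩
  exact h σ τ

/-! ### The coproduct dual to the disjoint union -/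

theorem tensorCoeffLin_comulDisj (σ τ : FinGraphNo) (x : LGraphNo) :
    tensorCoeffLin σ τ (comulDisj x) = x (σ.disjUnion τ) := by
  classical
  suffices h : tensorCoeffLin σ τ ∘ₗ comulDisj = Finsupp.lapply (σ.disjUnion τ) from
    LinearMap.congr_fun h x
  refine linearMap_ext_gr fun γ => ?_
  rw [LinearMap.comp_apply, comulDisj_gr, map_sum, Finsupp.lapply_apply, gr_apply]
  have hterm : ∀ p ∈ (finite_disjUnion_eq γ).toFinset,
      tensorCoeffLin σ τ (gr p.1 ⊗ₜ[ℝ] gr p.2) = if p = (σ, τ) then 1 else 0 := by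
    rintro ⟨p, q⟩ -
    simp only [tensorCoeffLin_tmul, gr_apply, Prod.mk.injEq]
    split_ifs <;> simp_all
  rw [Finset.sum_congr rfl hterm, Finset.sum_ite_eq']
  exact if_congr ((mem_splittings γ (σ, τ)).trans eq_comm) rfl rfl

/-- Both sides are the sum over all triples of graphs with a given disjoint union. -/
theorem comulDisj_coassoc :
    TensorProduct.assoc ℝ LGraphNo LGraphNo LGraphNo ∘ₗ comulDisj.rTensor LGraphNo ∘ₗ comulDisj =
      comulDisj.lTensor LGraphNo ∘ₗ comulDisj := by
  refine linearMap_ext_gr (M := LGraphNo ⊗[ℝ] (LGraphNo ⊗[ℝ] LGraphNo)) fun τ => ?_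
  simp only [LinearMap.comp_apply, comulDisj_gr, map_sum, LinearMap.rTensor_tmul,
    LinearMap.lTensor_tmul, TensorProduct.sum_tmul, TensorProduct.tmul_sum, LinearEquiv.coe_coe,
    TensorProduct.assoc_tmul]
  rw [Finset.sum_sigma', Finset.sum_sigma']
  refine Finset.sum_bij' (fun x _ => ⟨(x.2.1, x.2.2.disjUnion x.1.2), (x.2.2, x.1.2)⟩)
    (fun x _ => ⟨(x.1.1.disjUnion x.2.1, x.2.2), (x.1.1, x.2.1)⟩) ?_ ?_ ?_ ?_ ?_
  · rintro ⟨⟨a, b⟩, ⟨c, d⟩⟩ h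
    simp only [Finset.mem_sigma, mem_splittings] at h ⊢
    obtain ⟨rfl, rfl⟩ := h
    simp [FinGraphNo.disjUnion_assoc]
  · rintro ⟨⟨a, b⟩, ⟨c, d⟩⟩ h
    simp only [Finset.mem_sigma, mem_splittings] at h ⊢
    obtain ⟨rfl, rfl⟩ := h
    simp [FinGraphNo.disjUnion_assoc]
  · rintro ⟨⟨a, b⟩, ⟨c, d⟩⟩ h
    simp only [Finset.mem_sigma, mem_splittings] at h
    obtain ⟨rfl, rfl⟩ := h
    rfl
  · rintro ⟨⟨a, b⟩, ⟨c, d⟩⟩ h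
    simp only [Finset.mem_sigma, mem_splittings] at h
    obtain ⟨rfl, rfl⟩ := h
    rfl
  · rintro ⟨⟨a, b⟩, ⟨c, d⟩⟩ -
    rfl

theorem comulDisj_rTensor_counit :
    counitGraph.rTensor LGraphNo ∘ₗ comulDisj = TensorProduct.mk ℝ _ _ 1 := by
  classical
  refine linearMap_ext_gr (M := ℝ ⊗[ℝ] LGraphNo) fun τ => ?_
  simp only [LinearMap.comp_apply, comulDisj_gr, map_sum, LinearMap.rTensor_tmul, counitGraph_gr]
  rw [Finset.sum_eq_single (FinGraphNo.empty, τ)]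
  · simp
  · rintro ⟨a, b⟩ h hne
    simp only [Set.Finite.mem_toFinset, Set.mem_ofPred_eq] at h
    rw [if_neg, TensorProduct.zero_tmul]
    rintro rfl
    exact hne (by rw [← h, FinGraphNo.empty_disjUnion])
  · intro h
    simp [FinGraphNo.empty_disjUnion] at h

theorem comulDisj_lTensor_counit :
    counitGraph.lTensor LGraphNo ∘ₗ comulDisj = (TensorProduct.mk ℝ _ _).flip 1 := by
  classical
  refine linearMap_ext_gr (M := LGraphNo ⊗[ℝ] ℝ) fun τ => ?_
  simp only [LinearMap.comp_apply, comulDisj_gr, map_sum, LinearMap.lTensor_tmul, counitGraph_gr]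
  rw [Finset.sum_eq_single (τ, FinGraphNo.empty)]
  · simp
  · rintro ⟨a, b⟩ h hne
    simp only [Set.Finite.mem_toFinset, Set.mem_ofPred_eq] at h
    rw [if_neg, TensorProduct.tmul_zero]
    rintro rfl
    exact hne (by rw [← h, FinGraphNo.disjUnion_empty])
  · intro h
    simp [FinGraphNo.disjUnion_empty] at h

/-! ### The divided powers coproduct -/

section Components

variable {V W : Type} {G : SimpleGraph V} {H : SimpleGraph W}

/-- The components of a disjoint union. -/
def sumComponentEquiv (G : SimpleGraph V) (H : SimpleGraph W) :
    (G ⊕g H).ConnectedComponent ≃ G.ConnectedComponent ⊕ H.ConnectedComponent where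
  toFun := SimpleGraph.ConnectedComponent.lift
    (Sum.map G.connectedComponentMk H.connectedComponentMk) fun _ _ p _ =>
      apply_eq_of_reachable (by
        rintro (v | v) (w | w) h
        · exact congrArg Sum.inl (connectedComponentMk_eq_of_adj (SimpleGraph.sum_adj_inl.1 h))
        · simp at h
        · simp at h
        · exact congrArg Sum.inr (connectedComponentMk_eq_of_adj (SimpleGraph.sum_adj_inr.1 h)))
        p.reachable
  invFun := Sum.elim (SimpleGraph.ConnectedComponent.map SimpleGraph.Embedding.sumInl.toHom)
    (SimpleGraph.ConnectedComponent.map SimpleGraph.Embedding.sumInr.toHom)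
  left_inv c := by
    induction c using SimpleGraph.ConnectedComponent.ind with
    | h v => rcases v with v | v <;> rfl
  right_inv c := by
    rcases c with c | c <;> induction c using SimpleGraph.ConnectedComponent.ind <;> rfl

/-- The component of `G` that contains a given component of the subgraph formed by the components
in `S`. -/
def compInduceComponentMap (S : Set G.ConnectedComponent) :
    (compInduce G S).ConnectedComponent → S :=
  SimpleGraph.ConnectedComponent.lift
      (fun v => (⟨G.connectedComponentMk v.1, v.2⟩ : S)) fun _ _ p _ =>
    apply_eq_of_reachable (f := fun v => (⟨G.connectedComponentMk v.1, v.2⟩ : S))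
      (fun _ _ h => Subtype.ext (connectedComponentMk_eq_of_adj (SimpleGraph.induce_adj.1 h)))
      p.reachable

theorem compInduce_reachable {S : Set G.ConnectedComponent} {v w : V} (h : G.Reachable v w)
    (hv : G.connectedComponentMk v ∈ S) (hw : G.connectedComponentMk w ∈ S) :
    (compInduce G S).Reachable ⟨v, hv⟩ ⟨w, hw⟩ := by
  obtain ⟨p⟩ := h
  induction p with
  | nil => rfl
  | @cons a b c hadj _ ih =>
    have hb : G.connectedComponentMk b ∈ S := connectedComponentMk_eq_of_adj hadj ▸ hv
    refine SimpleGraph.Reachable.trans (SimpleGraph.Adj.reachable ?_) (ih hb hw)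
    exact hadj

theorem compInduceComponentMap_bijective (S : Set G.ConnectedComponent) :
    Function.Bijective (compInduceComponentMap S) := by
  constructor
  · intro c d h
    induction c using SimpleGraph.ConnectedComponent.ind with
    | h v =>
      induction d using SimpleGraph.ConnectedComponent.ind with
      | h w =>
        have h' : G.connectedComponentMk v = G.connectedComponentMk w := congrArg Subtype.val h
        exact SimpleGraph.ConnectedComponent.sound
          (compInduce_reachable (SimpleGraph.ConnectedComponent.exact h') v.2 w.2)
  · rintro ⟨c, hc⟩
    induction c using SimpleGraph.ConnectedComponent.ind with
    | h v => exact ⟨(compInduce G S).connectedComponentMk ⟨v, hc⟩, rfl⟩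

/-- A set in a disjoint union is a pair of sets. -/
def setSumEquiv {A B : Type} : Set (A ⊕ B) ≃ Set A × Set B where
  toFun S := (Sum.inl ⁻¹' S, Sum.inr ⁻¹' S)
  invFun p := {x | Sum.elim (· ∈ p.1) (· ∈ p.2) x}
  left_inv S := by ext (x | x) <;> rfl
  right_inv p := rfl

/-- An isomorphism restricts to the parts formed by corresponding components. -/
def compInduceIso (e : G ≃g H) (S : Set H.ConnectedComponent) :
    compInduce G (e.connectedComponentEquiv ⁻¹' S) ≃g compInduce H S :=
  ⟨e.toEquiv.subtypeEquiv fun _ => Iff.rfl, e.map_rel_iff⟩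

/-- A graph is the disjoint union of a set of its components and the complementary set. -/
def compInduceSumCompl (S : Set G.ConnectedComponent) :
    (compInduce G S ⊕g compInduce G Sᶜ) ≃g G :=
  open scoped Classical in
  { Equiv.sumCompl (fun v => G.connectedComponentMk v ∈ S) with
    map_rel_iff' := by
      rintro (⟨v, hv⟩ | ⟨v, hv⟩) (⟨w, hw⟩ | ⟨w, hw⟩)
      · exact Iff.rfl
      · refine iff_of_false (fun h => hw ?_) (by simp)
        have h : G.Adj v w := h
        change G.connectedComponentMk w ∈ S
        rwa [← connectedComponentMk_eq_of_adj h]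
      · refine iff_of_false (fun h => hv ?_) (by simp)
        have h : G.Adj v w := h
        change G.connectedComponentMk v ∈ S
        rwa [connectedComponentMk_eq_of_adj h]
      · exact Iff.rfl }

/-- A union of components of a disjoint union splits into its two parts. -/
def compInduceSum (S : Set (G.ConnectedComponent ⊕ H.ConnectedComponent)) :
    compInduce (G ⊕g H) (sumComponentEquiv G H ⁻¹' S) ≃g
      (compInduce G (Sum.inl ⁻¹' S) ⊕g compInduce H (Sum.inr ⁻¹' S)) where
  toEquiv := Equiv.subtypeSum
  map_rel_iff' := by
    rintro ⟨v | v, hv⟩ ⟨w | w, hw⟩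
    all_goals exact Iff.rfl

end Components

open scoped Classical in
/-- The divided powers coproduct, computed from any graph in an isomorphism class. -/
theorem comulDP_mk {V : Type} [Finite V] {G : SimpleGraph V} (hG : NoIsolated G)
    [Fintype G.ConnectedComponent] :
    comulDP (gr (FinGraphNo.mk G hG)) = ∑ S : Set G.ConnectedComponent,
      gr (FinGraphNo.mk _ (hG.compInduce S)) ⊗ₜ[ℝ] gr (FinGraphNo.mk _ (hG.compInduce Sᶜ)) := by
  obtain ⟨e⟩ := FinGraphNo.mk_graph_iso hG
  rw [comulDP, linExt_gr]
  refine (Fintype.sum_equiv (Equiv.Set.congr e.connectedComponentEquiv.symm) _ _ fun S => ?_).symm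
  have hS : Equiv.Set.congr e.connectedComponentEquiv.symm S = e.connectedComponentEquiv ⁻¹' S :=
    Equiv.image_symm_eq_preimage _ _
  rw [hS]
  congr 2
  · exact (FinGraphNo.mk_eq_mk _ _).2 ⟨(compInduceIso e S).symm⟩
  · exact (FinGraphNo.mk_eq_mk _ _).2 ⟨(compInduceIso e Sᶜ).symm⟩

/-- Sets of components of a disjoint union are pairs of sets of components of the two parts. -/
theorem comulDP_gr_disjUnion (σ τ : FinGraphNo) :
    comulDP (gr (σ.disjUnion τ)) =
      TensorProduct.map₂ mulDisj mulDisj (comulDP (gr σ)) (comulDP (gr τ)) := by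
  classical
  have hf : Finite (σ.graph ⊕g τ.graph).ConnectedComponent := Quot.finite _
  cases nonempty_fintype (σ.graph ⊕g τ.graph).ConnectedComponent
  rw [FinGraphNo.disjUnion, comulDP_mk]
  have hm : comulDP (gr σ) = _ := linExt_gr _ _
  have hm' : comulDP (gr τ) = _ := linExt_gr _ _
  rw [hm, hm']
  simp only [map_sum, LinearMap.sum_apply, TensorProduct.map₂_apply_tmul,
    TensorProduct.map_tmul, mulDisj_gr]
  rw [Finset.sum_comm, ← Fintype.sum_prod_type']
  let E : Set (σ.graph ⊕g τ.graph).ConnectedComponent ≃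
      Set σ.graph.ConnectedComponent × Set τ.graph.ConnectedComponent :=
    (Equiv.Set.congr (sumComponentEquiv σ.graph τ.graph)).trans setSumEquiv
  refine (Fintype.sum_equiv E.symm _ _ fun p => ?_).symm
  have h1 : E.symm p = sumComponentEquiv σ.graph τ.graph ⁻¹' (setSumEquiv.symm p) :=
    Equiv.image_symm_eq_preimage _ _
  have h2 : (E.symm p)ᶜ =
      sumComponentEquiv σ.graph τ.graph ⁻¹' (setSumEquiv.symm (p.1ᶜ, p.2ᶜ)) := by
    rw [h1, ← Set.preimage_compl]
    congr 1
    ext (c | c) <;> rfl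
  have key : ∀ q S, S = sumComponentEquiv σ.graph τ.graph ⁻¹' (setSumEquiv.symm q) →
      (σ.components q.1).disjUnion (τ.components q.2) =
        FinGraphNo.mk _ ((σ.noIsolated.sum τ.noIsolated).compInduce S) := by
    rintro ⟨S₁, S₂⟩ _ rfl
    exact (FinGraphNo.mk_disjUnion_mk _ _).trans
      ((FinGraphNo.mk_eq_mk _ _).2
        ⟨(compInduceSum (G := σ.graph) (H := τ.graph) (setSumEquiv.symm (S₁, S₂))).symm⟩)
  rw [key _ _ h1, key (p.1ᶜ, p.2ᶜ) _ h2]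

/-! ### The antipode of the polynomial Hopf algebra -/

/-- The antipode of the polynomial Hopf algebra multiplies a graph with `n` components by
`(-1) ^ n`. -/
def antipodePoly : LGraphNo →ₗ[ℝ] LGraphNo :=
  linExt fun τ => ((-1 : ℝ) ^ Nat.card τ.graph.ConnectedComponent) • gr τ

theorem antipodePoly_components (τ : FinGraphNo) (S : Set τ.graph.ConnectedComponent) :
    antipodePoly (gr (τ.components S)) = ((-1 : ℝ) ^ Nat.card S) • gr (τ.components S) := by
  obtain ⟨e⟩ := FinGraphNo.mk_graph_iso (τ.noIsolated.compInduce S)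
  rw [antipodePoly, linExt_gr]
  congr 2
  exact Nat.card_congr (e.connectedComponentEquiv.trans
    (Equiv.ofBijective _ (compInduceComponentMap_bijective S)))

theorem disjUnion_components (τ : FinGraphNo) (S : Set τ.graph.ConnectedComponent) :
    (τ.components S).disjUnion (τ.components Sᶜ) = τ := by
  conv_rhs => rw [← FinGraphNo.mk_graph τ]
  exact (FinGraphNo.mk_disjUnion_mk _ _).trans
    ((FinGraphNo.mk_eq_mk _ _).2 ⟨compInduceSumCompl S⟩)

open scoped Classical in
theorem sum_set_neg_one_pow_card (α : Type) [Fintype α] :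
    ∑ S : Set α, (-1 : ℝ) ^ Nat.card S = if IsEmpty α then 1 else 0 := by
  have h := Finset.sum_powerset_neg_one_pow_card (x := (Finset.univ : Finset α))
  rw [← Fintype.sum_equiv Fintype.finsetEquivSet (fun s => (-1 : ℝ) ^ s.card) _
    (fun s => by simp), ← Finset.powerset_univ]
  simp only [Finset.univ_eq_empty_iff] at h
  exact_mod_cast h

open scoped Classical in
theorem sum_sign_smul (τ : FinGraphNo) :
    ∑ S : Set τ.graph.ConnectedComponent, ((-1 : ℝ) ^ Nat.card S) • gr τ =
      counitGraph (gr τ) • gr FinGraphNo.empty := by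
  rw [← Finset.sum_smul, sum_set_neg_one_pow_card, counitGraph_gr]
  have h : IsEmpty τ.graph.ConnectedComponent ↔ τ = FinGraphNo.empty := by
    rw [FinGraphNo.eq_empty_iff]
    constructor
    · intro h
      have h' : IsEmpty (Fin τ.order) := ⟨fun v => h.1 (τ.graph.connectedComponentMk v)⟩
      exact (Fintype.card_fin _).symm.trans (Fintype.card_eq_zero_iff.2 h')
    · intro h
      have h' : IsEmpty (Fin τ.order) := Fintype.card_eq_zero_iff.1 (by simpa using h)
      exact ⟨fun c => c.ind fun v => h'.1 v⟩
  rw [if_congr h rfl rfl]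
  split_ifs with h
  · rw [h]
  · simp

theorem antipodePoly_left (x : LGraphNo) :
    TensorProduct.lift mulDisj (antipodePoly.rTensor LGraphNo (comulDP x)) =
      counitGraph x • gr FinGraphNo.empty := by
  classical
  suffices h : TensorProduct.lift mulDisj ∘ₗ antipodePoly.rTensor LGraphNo ∘ₗ comulDP =
      counitGraph.smulRight (gr FinGraphNo.empty) from LinearMap.congr_fun h x
  refine linearMap_ext_gr fun τ => ?_
  have hm : comulDP (gr τ) = _ := linExt_gr _ _
  simp only [LinearMap.comp_apply, hm, map_sum, LinearMap.rTensor_tmul, TensorProduct.lift.tmul,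
    antipodePoly_components, map_smul, LinearMap.smul_apply, mulDisj_gr, disjUnion_components]
  exact sum_sign_smul τ

theorem antipodePoly_right (x : LGraphNo) :
    TensorProduct.lift mulDisj (antipodePoly.lTensor LGraphNo (comulDP x)) =
      counitGraph x • gr FinGraphNo.empty := by
  classical
  suffices h : TensorProduct.lift mulDisj ∘ₗ antipodePoly.lTensor LGraphNo ∘ₗ comulDP =
      counitGraph.smulRight (gr FinGraphNo.empty) from LinearMap.congr_fun h x
  refine linearMap_ext_gr fun τ => ?_
  have hm : comulDP (gr τ) = _ := linExt_gr _ _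
  simp only [LinearMap.comp_apply, hm, map_sum, LinearMap.lTensor_tmul, TensorProduct.lift.tmul,
    antipodePoly_components, map_smul, mulDisj_gr, disjUnion_components]
  refine Eq.trans ?_ (sum_sign_smul τ)
  exact Fintype.sum_equiv ⟨compl, compl, compl_compl, compl_compl⟩ _ _ fun S => rfl

/-! ### Coefficients of the quasi-shuffle products -/

theorem tensorCoeff_sum_single {α ι : Type} (σ τ : α) (s : Finset ι) (f g : ι → α)
    [DecidableEq α] : tensorCoeff σ τ (∑ i ∈ s, Finsupp.single (f i) (1 : ℝ) ⊗ₜ[ℝ]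
      Finsupp.single (g i) (1 : ℝ)) =
        ∑ i ∈ s, (if σ = f i then 1 else 0) * (if τ = g i then 1 else 0) := by
  rw [← tensorCoeffLin_apply, map_sum]
  refine Finset.sum_congr rfl fun i _ => ?_
  rw [tensorCoeffLin_tmul, Finsupp.single_apply, Finsupp.single_apply]
  simp only [eq_comm]

open scoped Classical in
/-- The coefficient of `γ` in a product is a sum over the pairs of edge sets that cover `γ`. -/
theorem mulQs_apply (x y : LGraphNo) (γ : FinGraphNo) :
    mulQs x y γ = ∑ p : Set γ.graph.edgeSet × Set γ.graph.edgeSet with p.1ᶜ ⊆ p.2,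
      x (γ.restrict p.1) * y (γ.restrict p.2) := by
  suffices h : mulQs.compr₂ (Finsupp.lapply γ) =
      ∑ p : Set γ.graph.edgeSet × Set γ.graph.edgeSet with p.1ᶜ ⊆ p.2,
        (LinearMap.mul ℝ ℝ).compl₁₂ (Finsupp.lapply (γ.restrict p.1))
          (Finsupp.lapply (γ.restrict p.2)) by
    have h' := LinearMap.congr_fun₂ h x y
    simpa only [LinearMap.compr₂_apply, LinearMap.sum_apply, LinearMap.compl₁₂_apply,
      Finsupp.lapply_apply, LinearMap.mul_apply'] using h'
  refine bilin_ext_gr fun σ τ => ?_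
  simp only [LinearMap.compr₂_apply, LinearMap.sum_apply, LinearMap.compl₁₂_apply,
    Finsupp.lapply_apply, LinearMap.mul_apply', gr_apply]
  rw [mulQs, bilinExt_gr, sumGraphs_apply]
  exact tensorCoeff_sum_single _ _ _ _ _

/-- The inclusion of the span of the graphs without isolated vertices in the span of all
graphs. -/
def inclGraph : LGraphNo →ₗ[ℝ] LGraph :=
  Finsupp.lmapDomain ℝ ℝ fun τ : FinGraphNo => (τ.1 : FinGraph)

theorem inclGraph_apply (x : LGraphNo) (τ : FinGraphNo) : inclGraph x τ.1 = x τ :=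
  Finsupp.mapDomain_apply Subtype.val_injective x τ

theorem inclGraph_apply_of_not (x : LGraphNo) (ρ : FinGraph) (h : ¬ NoIsolated ρ.graph) :
    inclGraph x ρ = 0 := by
  refine Finsupp.mapDomain_of_notMem_range x ρ ?_
  rintro ⟨τ, rfl⟩
  exact h τ.2

open scoped Classical in
theorem inclGraph_gr (τ : FinGraphNo) (ρ : FinGraph) :
    inclGraph (gr τ) ρ = if τ.1 = ρ then 1 else 0 := by
  rw [inclGraph, gr, Finsupp.lmapDomain_apply, Finsupp.mapDomain_single, Finsupp.single_apply]

open scoped Classical in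
/-- The coefficient of `γ` in a product is a sum over the pairs of vertex sets that cover `γ`. -/
theorem mulQis_apply (x y : LGraphNo) (γ : FinGraphNo) :
    mulQis x y γ = ∑ p : Set (Fin γ.order) × Set (Fin γ.order) with p.1ᶜ ⊆ p.2,
      inclGraph x (γ.1.induced p.1) * inclGraph y (γ.1.induced p.2) := by
  suffices h : mulQis.compr₂ (Finsupp.lapply γ) =
      ∑ p : Set (Fin γ.order) × Set (Fin γ.order) with p.1ᶜ ⊆ p.2,
        (LinearMap.mul ℝ ℝ).compl₁₂ (Finsupp.lapply (γ.1.induced p.1) ∘ₗ inclGraph)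
          (Finsupp.lapply (γ.1.induced p.2) ∘ₗ inclGraph) by
    have h' := LinearMap.congr_fun₂ h x y
    simpa only [LinearMap.compr₂_apply, LinearMap.sum_apply, LinearMap.compl₁₂_apply,
      LinearMap.comp_apply, Finsupp.lapply_apply, LinearMap.mul_apply'] using h'
  refine bilin_ext_gr fun σ τ => ?_
  simp only [LinearMap.compr₂_apply, LinearMap.sum_apply, LinearMap.compl₁₂_apply,
    LinearMap.comp_apply, Finsupp.lapply_apply, LinearMap.mul_apply', inclGraph_gr]
  rw [mulQis, bilinExt_gr]
  exact tensorCoeff_sum_single _ _ _ _ _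

/-! ### Counting surjections as a linear map -/

theorem order_le_of_surjCount {r : Prop} {τ σ : FinGraphNo}
    (h : surjCount r τ.graph σ.graph ≠ 0) : σ.order ≤ τ.order :=
  order_le_of_epi (s := surjHoms r τ.graph σ.graph) (fun _ hf => hf.1) h

/-- The linear map that counts surjections: `Φ_{ei←hom}` if `r` holds, `Φ_{vi←hom}` otherwise. -/
def surjMap (r : Prop) : LGraphNo →ₗ[ℝ] LGraphNo :=
  linExt fun τ => sumGraphs (fun σ => (surjCount r τ.graph σ.graph : ℝ)) τ.order
    fun _ h => order_le_of_surjCount (by exact_mod_cast h)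

theorem surjMap_gr_apply (r : Prop) (τ σ : FinGraphNo) :
    surjMap r (gr τ) σ = surjCount r τ.graph σ.graph := by
  rw [surjMap, linExt_gr, sumGraphs_apply]

theorem surjMap_gr_mk_apply (r : Prop) (τ : FinGraphNo) {V : Type} [Finite V] {G : SimpleGraph V}
    (hG : NoIsolated G) : surjMap r (gr τ) (FinGraphNo.mk G hG) = surjCount r τ.graph G := by
  obtain ⟨e⟩ := FinGraphNo.mk_graph_iso hG
  rw [surjMap_gr_apply, surjCount_congr r SimpleGraph.Iso.refl e]

/-- The coefficients count surjections onto all graphs, as there are none onto graphs with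
isolated vertices. -/
theorem inclGraph_surjMap_gr_mk (r : Prop) (τ : FinGraphNo) {V : Type} [Finite V]
    (G : SimpleGraph V) :
    inclGraph (surjMap r (gr τ)) (FinGraph.mk G) = surjCount r τ.graph G := by
  by_cases hG : NoIsolated G
  · exact (inclGraph_apply _ (FinGraphNo.mk G hG)).trans (surjMap_gr_mk_apply r τ hG)
  · obtain ⟨e⟩ := FinGraph.mk_graph_iso G
    have h0 : surjCount r τ.graph G = 0 := by
      have : IsEmpty (surjHoms r τ.graph G) :=
        ⟨fun f => hG (τ.noIsolated.of_mem_surjHoms f.2)⟩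
      exact Nat.card_of_isEmpty
    rw [h0, inclGraph_apply_of_not _ _ fun h => hG (h.of_iso e), Nat.cast_zero]

theorem PhiEiHom_eq : PhiEiHom = surjMap True := by
  refine linearMap_ext_gr fun τ => Finsupp.ext fun σ => ?_
  rw [surjMap_gr_apply, PhiEiHom, linExt_gr, sumGraphs_apply]
  have h : RegEpi τ σ = surjHoms True τ.graph σ.graph := by
    ext f
    exact and_congr_right fun _ => (edgeSurjective_iff f).symm.trans
      ⟨fun h _ => h, fun h => h trivial⟩
  rw [h]
  rfl

theorem PhiViHom_eq : PhiViHom = surjMap False := by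
  refine linearMap_ext_gr fun τ => Finsupp.ext fun σ => ?_
  rw [surjMap_gr_apply, PhiViHom, linExt_gr, sumGraphs_apply]
  have h : Epi τ σ = surjHoms False τ.graph σ.graph := by
    ext f
    exact ⟨fun h => ⟨h, False.elim⟩, fun h => h.1⟩
  rw [h]
  rfl

/-! ### Triangularity -/

/-- The number of vertices, then the number of non-adjacent pairs of vertices, ordered
lexicographically. -/
def graphRank (τ : FinGraphNo) : ℕ ×ₗ ℕ :=
  toLex (τ.order, Nat.card {p : Fin τ.order × Fin τ.order // ¬ τ.graph.Adj p.1 p.2})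

/-- A proper surjective image has fewer vertices, or as many vertices and more edges. -/
theorem graphRank_lt {τ σ : FinGraphNo} (f : τ.graph →g σ.graph) (hf : Function.Surjective f)
    (hne : σ ≠ τ) : graphRank σ < graphRank τ := by
  have hle : σ.order ≤ τ.order := by simpa using Fintype.card_le_of_surjective f hf
  rw [graphRank, graphRank, Prod.Lex.toLex_lt_toLex]
  rcases hle.lt_or_eq with h | h
  · exact Or.inl h
  right
  refine ⟨h, ?_⟩
  have hb : Function.Bijective f :=
    (Fintype.bijective_iff_surjective_and_card f).2 ⟨hf, by simp [h]⟩
  let e := Equiv.ofBijective f hb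
  -- Preimages of non-adjacent pairs are non-adjacent.
  let F : {p : Fin σ.order × Fin σ.order // ¬ σ.graph.Adj p.1 p.2} →
      {p : Fin τ.order × Fin τ.order // ¬ τ.graph.Adj p.1 p.2} := fun p =>
    ⟨(e.symm p.1.1, e.symm p.1.2), fun hadj => p.2 (by
      have h' : σ.graph.Adj (e (e.symm p.1.1)) (e (e.symm p.1.2)) := f.map_adj hadj
      rwa [e.apply_symm_apply, e.apply_symm_apply] at h')⟩
  have hF : Function.Injective F := by
    rintro ⟨⟨a, b⟩, _⟩ ⟨⟨c, d⟩, _⟩ h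
    have h' := Prod.ext_iff.1 (congrArg Subtype.val h)
    exact Subtype.ext (Prod.ext (e.symm.injective h'.1) (e.symm.injective h'.2))
  refine (Nat.card_le_card_of_injective F hF).lt_of_ne fun heq => hne ?_
  -- If no edge is added then `f` is an isomorphism.
  have hF' : Function.Surjective F := ((Nat.bijective_iff_injective_and_card F).2 ⟨hF, heq⟩).2
  rw [eq_comm, FinGraphNo.eq_iff]
  refine ⟨⟨e, fun {v w} => ⟨fun hadj => ?_, fun hadj => f.map_adj hadj⟩⟩⟩
  by_contra hn
  obtain ⟨p, hp⟩ := hF' ⟨(v, w), hn⟩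
  have hp' := Prod.ext_iff.1 (congrArg Subtype.val hp)
  apply p.2
  rw [← e.apply_symm_apply p.1.1, ← e.apply_symm_apply p.1.2]
  have h1 : e.symm p.1.1 = v := hp'.1
  have h2 : e.symm p.1.2 = w := hp'.2
  rw [h1, h2]
  exact hadj

/-- Triangularity with respect to `graphRank`; the diagonal is nonzero since identities are
surjective. -/
theorem surjMap_bijective (r : Prop) : Function.Bijective (surjMap r) := by
  refine bijective_of_triangular graphRank (surjMap r) (fun τ => ?_) fun τ σ h hne => ?_
  · change surjMap r (gr τ) τ ≠ 0
    rw [surjMap_gr_apply, Nat.cast_ne_zero]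
    have : Nonempty (surjHoms r τ.graph τ.graph) :=
      ⟨⟨SimpleGraph.Hom.id, Function.surjective_id, fun _ w w' h => ⟨w, w', h, rfl, rfl⟩⟩⟩
    exact Nat.card_pos.ne'
  · have h' : (surjCount r τ.graph σ.graph : ℝ) ≠ 0 := by
      rw [← surjMap_gr_apply]
      exact h
    obtain ⟨⟨f, hf⟩⟩ := (Nat.card_ne_zero.1 (Nat.cast_ne_zero.1 h')).1
    exact graphRank_lt f hf.1 hne

/-! ### Compatibility with the operations -/

open scoped Classical in
/-- The empty graph only maps onto itself, and only the empty graph maps to it. -/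
theorem surjCount_empty {r : Prop} {τ σ : FinGraphNo}
    (h : τ = FinGraphNo.empty ∨ σ = FinGraphNo.empty) :
    surjCount r τ.graph σ.graph = if τ = σ then 1 else 0 := by
  have hτσ : Nonempty (surjHoms r τ.graph σ.graph) → τ.order = 0 ∧ σ.order = 0 := by
    rintro ⟨f, hf⟩
    rcases h with h | h
    · have h0 := (FinGraphNo.eq_empty_iff _).1 h
      have : σ.order ≤ τ.order := by simpa using Fintype.card_le_of_surjective f hf.1
      omega
    · have h0 := (FinGraphNo.eq_empty_iff _).1 h
      refine ⟨?_, h0⟩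
      by_contra hne
      have hlt := (f ⟨0, Nat.pos_of_ne_zero hne⟩).2
      omega
  split_ifs with he
  · subst he
    have h0 : τ.order = 0 := (FinGraphNo.eq_empty_iff _).1 (or_self_iff.1 h)
    have hemp : IsEmpty (Fin τ.order) := Fintype.card_eq_zero_iff.1 (by simpa using h0)
    refine Nat.card_eq_one_iff_unique.2 ⟨⟨fun f g => Subtype.ext (RelHom.ext hemp.elim)⟩,
      ⟨SimpleGraph.Hom.id, Function.surjective_id, fun _ w w' h => ⟨w, w', h, rfl, rfl⟩⟩⟩
  · have : IsEmpty (surjHoms r τ.graph σ.graph) := by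
      rw [← not_nonempty_iff]
      intro hn
      obtain ⟨h1, h2⟩ := hτσ hn
      exact he (((FinGraphNo.eq_empty_iff _).2 h1).trans ((FinGraphNo.eq_empty_iff _).2 h2).symm)
    exact Nat.card_of_isEmpty

theorem surjMap_empty (r : Prop) : surjMap r (gr FinGraphNo.empty) = gr FinGraphNo.empty := by
  classical
  ext σ
  rw [surjMap_gr_apply, surjCount_empty (Or.inl rfl), gr_apply]
  push_cast
  rfl

theorem counitGraph_surjMap (r : Prop) (x : LGraphNo) :
    counitGraph (surjMap r x) = counitGraph x := by
  classical
  suffices h : counitGraph ∘ₗ surjMap r = counitGraph from LinearMap.congr_fun h x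
  refine linearMap_ext_gr fun τ => ?_
  rw [LinearMap.comp_apply, counitGraph_apply, surjMap_gr_apply, surjCount_empty (Or.inr rfl),
    counitGraph_gr]
  push_cast
  rfl

theorem comulDisj_surjMap (r : Prop) (x : LGraphNo) :
    comulDisj (surjMap r x) = TensorProduct.map (surjMap r) (surjMap r) (comulDP x) := by
  classical
  suffices h : comulDisj ∘ₗ surjMap r = TensorProduct.map (surjMap r) (surjMap r) ∘ₗ comulDP from
    LinearMap.congr_fun h x
  refine linearMap_ext_gr fun τ => tensor_ext fun σ₁ σ₂ => ?_
  have hm : comulDP (gr τ) = _ := linExt_gr _ _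
  rw [LinearMap.comp_apply, LinearMap.comp_apply, hm, tensorCoeffLin_comulDisj,
    FinGraphNo.disjUnion, surjMap_gr_mk_apply, surjCount_sum_right]
  simp only [map_sum, TensorProduct.map_tmul, tensorCoeffLin_tmul]
  push_cast
  have hc : ∀ (S : Set τ.graph.ConnectedComponent) (σ : FinGraphNo),
      surjMap r (gr (τ.components S)) σ = surjCount r (compInduce τ.graph S) σ.graph := by
    intro S σ
    obtain ⟨e⟩ := FinGraphNo.mk_graph_iso (τ.noIsolated.compInduce S)
    rw [surjMap_gr_apply]
    exact congrArg _ (surjCount_congr r e SimpleGraph.Iso.refl)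
  exact Finset.sum_congr rfl fun S _ => by rw [hc, hc]

theorem surjMap_mulDisj_gr_apply (r : Prop) (σ τ γ : FinGraphNo) :
    surjMap r (mulDisj (gr σ) (gr τ)) γ = surjCount r (σ.graph ⊕g τ.graph) γ.graph := by
  obtain ⟨e⟩ := FinGraphNo.mk_graph_iso (FinGraphNo.noIsolated_sum σ τ)
  rw [mulDisj_gr, surjMap_gr_apply]
  exact congrArg _ (surjCount_congr r e SimpleGraph.Iso.refl)

theorem surjMap_true_mul (x y : LGraphNo) :
    surjMap True (mulDisj x y) = mulQs (surjMap True x) (surjMap True y) := by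
  classical
  suffices h : mulDisj.compr₂ (surjMap True) = mulQs.compl₁₂ (surjMap True) (surjMap True) from
    LinearMap.congr_fun₂ h x y
  refine bilin_ext_gr fun σ τ => Finsupp.ext fun γ => ?_
  rw [LinearMap.compr₂_apply, LinearMap.compl₁₂_apply, surjMap_mulDisj_gr_apply, mulQs_apply,
    surjCount_true_sum_left σ.noIsolated τ.noIsolated]
  push_cast
  refine Finset.sum_congr rfl fun p _ => ?_
  rw [FinGraphNo.restrict, FinGraphNo.restrict, surjMap_gr_mk_apply, surjMap_gr_mk_apply]

theorem surjMap_false_mul (x y : LGraphNo) :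
    surjMap False (mulDisj x y) = mulQis (surjMap False x) (surjMap False y) := by
  classical
  suffices h : mulDisj.compr₂ (surjMap False) = mulQis.compl₁₂ (surjMap False) (surjMap False) from
    LinearMap.congr_fun₂ h x y
  refine bilin_ext_gr fun σ τ => Finsupp.ext fun γ => ?_
  rw [LinearMap.compr₂_apply, LinearMap.compl₁₂_apply, surjMap_mulDisj_gr_apply, mulQis_apply,
    surjCount_false_sum_left]
  push_cast
  refine Finset.sum_congr rfl fun p _ => ?_
  exact (congrArg₂ (· * ·) (inclGraph_surjMap_gr_mk False σ (γ.graph.induce p.1))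
    (inclGraph_surjMap_gr_mk False τ (γ.graph.induce p.2))).symm

theorem intertwines_surjMap_true : polyOps.Intertwines qsOps (surjMap True) where
  map_mul := surjMap_true_mul
  map_one := surjMap_empty True
  map_comul := comulDisj_surjMap True
  map_counit := counitGraph_surjMap True

theorem intertwines_surjMap_false : polyOps.Intertwines qisOps (surjMap False) where
  map_mul := surjMap_false_mul
  map_one := surjMap_empty False
  map_comul := comulDisj_surjMap False
  map_counit := counitGraph_surjMap False

/-! ### The polynomial Hopf algebra -/

theorem mulDisj_assoc (x y z : LGraphNo) :
    mulDisj (mulDisj x y) z = mulDisj x (mulDisj y z) := by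
  have h1 : ∀ ρ σ, mulDisj (mulDisj (gr ρ) (gr σ)) = mulDisj (gr ρ) ∘ₗ mulDisj (gr σ) :=
    fun ρ σ => linearMap_ext_gr fun τ => by simp [FinGraphNo.disjUnion_assoc]
  have h2 : mulDisj.compr₂ (mulDisj.flip z) = mulDisj.compl₂ (mulDisj.flip z) :=
    bilin_ext_gr fun ρ σ => LinearMap.congr_fun (h1 ρ σ) z
  exact LinearMap.congr_fun₂ h2 x y

theorem comulDisj_empty :
    comulDisj (gr FinGraphNo.empty) = gr FinGraphNo.empty ⊗ₜ gr FinGraphNo.empty := by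
  classical
  refine tensor_ext fun σ τ => ?_
  rw [tensorCoeffLin_comulDisj, tensorCoeffLin_tmul]
  simp only [gr_apply, eq_comm (a := FinGraphNo.empty), FinGraphNo.disjUnion_eq_empty_iff]
  split_ifs <;> simp_all

/-- By injectivity of `surjMap`, this reduces to `comulDisj_empty`. -/
theorem comulDP_empty :
    comulDP (gr FinGraphNo.empty) = gr FinGraphNo.empty ⊗ₜ gr FinGraphNo.empty := by
  let e := LinearEquiv.ofBijective _ (surjMap_bijective True)
  apply (TensorProduct.congr e e).injective
  refine (comulDisj_surjMap True _).symm.trans ?_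
  rw [TensorProduct.congr_tmul]
  change _ = surjMap True _ ⊗ₜ surjMap True _
  rw [surjMap_empty, comulDisj_empty]

theorem polyOps_isHopf : polyOps.IsHopf antipodePoly where
  mul_assoc := mulDisj_assoc
  one_mul x := by
    suffices h : mulDisj (gr FinGraphNo.empty) = LinearMap.id from LinearMap.congr_fun h x
    exact linearMap_ext_gr fun τ => by simp [FinGraphNo.empty_disjUnion]
  mul_one x := by
    suffices h : mulDisj.flip (gr FinGraphNo.empty) = LinearMap.id from LinearMap.congr_fun h x
    exact linearMap_ext_gr fun τ => by simp [FinGraphNo.disjUnion_empty]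
  coassoc := coassoc_of_linearEquiv (LinearEquiv.ofBijective _ (surjMap_bijective True))
    (comulDisj_surjMap True) comulDisj_coassoc
  rTensor_counit := rTensor_counit_of_linearEquiv
    (LinearEquiv.ofBijective _ (surjMap_bijective True)) (comulDisj_surjMap True)
    (counitGraph_surjMap True) comulDisj_rTensor_counit
  lTensor_counit := lTensor_counit_of_linearEquiv
    (LinearEquiv.ofBijective _ (surjMap_bijective True)) (comulDisj_surjMap True)
    (counitGraph_surjMap True) comulDisj_lTensor_counit
  counit_one := by
    classical
    exact (counitGraph_gr _).trans (if_pos rfl)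
  counit_mul x y := by
    classical
    suffices h : mulDisj.compr₂ counitGraph =
        (LinearMap.mul ℝ ℝ).compl₁₂ counitGraph counitGraph from LinearMap.congr_fun₂ h x y
    refine bilin_ext_gr fun σ τ => ?_
    simp only [LinearMap.compr₂_apply, LinearMap.compl₁₂_apply, LinearMap.mul_apply', mulDisj_gr,
      counitGraph_gr, FinGraphNo.disjUnion_eq_empty_iff]
    split_ifs <;> simp_all
  comul_one := comulDP_empty
  comul_mul x y := by
    suffices h : mulDisj.compr₂ comulDP =
        (TensorProduct.map₂ mulDisj mulDisj).compl₁₂ comulDP comulDP from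
      LinearMap.congr_fun₂ h x y
    refine bilin_ext_gr (M := LGraphNo ⊗[ℝ] LGraphNo) fun σ τ => ?_
    rw [LinearMap.compr₂_apply, LinearMap.compl₁₂_apply, mulDisj_gr, comulDP_gr_disjUnion]
  antipode_left := antipodePoly_left
  antipode_right := antipodePoly_right

/-! ### Composition of the translation maps -/

open scoped Classical in
/-- The translation map from edge-restricted to vertex-induced quasi-shuffles sums the
coefficients over the spanning subgraphs. -/
theorem PhiViEi_apply (x : LGraphNo) (γ : FinGraphNo) :
    PhiViEi x γ = ∑ K ∈ spanningSubgraphs γ.graph, inclGraph x (FinGraph.mk K) := by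
  suffices h : Finsupp.lapply γ ∘ₗ PhiViEi =
      ∑ K ∈ spanningSubgraphs γ.graph, Finsupp.lapply (FinGraph.mk K) ∘ₗ inclGraph by
    have h' := LinearMap.congr_fun h x
    simpa only [LinearMap.sum_apply, LinearMap.comp_apply, Finsupp.lapply_apply] using h'
  refine linearMap_ext_gr fun τ => ?_
  simp only [LinearMap.sum_apply, LinearMap.comp_apply, Finsupp.lapply_apply, inclGraph_gr]
  rw [PhiViEi, linExt_gr, Finsupp.smul_apply, sumGraphs_apply]
  have hcard : (Mono τ γ ∩ Epi τ γ).ncard = Nat.card {f : τ.graph →g γ.graph //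
      Function.Bijective f} := rfl
  have haut : (numAut τ : ℝ) ≠ 0 := by
    have : Finite (τ.graph ≃g τ.graph) :=
      Finite.of_injective (fun e => (e : Fin τ.order → Fin τ.order)) DFunLike.coe_injective
    have : Nonempty (τ.graph ≃g τ.graph) := ⟨SimpleGraph.Iso.refl⟩
    exact Nat.cast_ne_zero.2 Nat.card_pos.ne'
  rw [hcard, card_bijective_hom, Nat.cast_sum, smul_eq_mul, Finset.mul_sum]
  refine Finset.sum_congr rfl fun K _ => ?_
  have hiff : τ.1 = FinGraph.mk K ↔ Nonempty (τ.graph ≃g K) := by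
    conv_lhs => rw [← FinGraph.mk_graph τ.1]
    exact FinGraph.mk_eq_mk
  rw [if_congr hiff rfl rfl]
  split_ifs
  · rw [numAut] at haut ⊢
    field_simp
  · simp

theorem PhiViEi_comp_PhiEiHom : PhiViEi ∘ₗ PhiEiHom = PhiViHom := by
  classical
  rw [PhiEiHom_eq, PhiViHom_eq]
  refine linearMap_ext_gr fun τ => Finsupp.ext fun γ => ?_
  rw [LinearMap.comp_apply, PhiViEi_apply, surjMap_gr_apply, surjCount_false_eq_sum]
  push_cast
  exact Finset.sum_congr rfl fun K _ => inclGraph_surjMap_gr_mk True τ K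

end

theorem mainTheorem2 :
    IsHopfIso qsOps qisOps PhiViEi ∧
    IsHopfIso polyOps qsOps PhiEiHom ∧
    PhiViEi ∘ₗ PhiEiHom = PhiViHom ∧
    IsHopfIso polyOps qisOps PhiViHom := by
  have hpoly : polyOps.AsHopfAlgebra := polyOps_isHopf.asHopfAlgebra
  have hei : polyOps.Intertwines qsOps PhiEiHom := PhiEiHom_eq ▸ intertwines_surjMap_true
  have hvi : polyOps.Intertwines qisOps PhiViHom := PhiViHom_eq ▸ intertwines_surjMap_false
  have bei : Function.Bijective PhiEiHom := PhiEiHom_eq ▸ surjMap_bijective True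
  have bvi : Function.Bijective PhiViHom := PhiViHom_eq ▸ surjMap_bijective False
  have hcomp := PhiViEi_comp_PhiEiHom
  have hviei : qsOps.Intertwines qisOps PhiViEi := hei.of_comp bei.2 (hcomp ▸ hvi)
  have bviei : Function.Bijective PhiViEi := by
    rw [← hcomp, LinearMap.coe_comp] at bvi
    exact (Function.Bijective.of_comp_iff _ bei).1 bvi
  exact ⟨hviei.isHopfIso (hpoly.transport (LinearEquiv.ofBijective _ bei) hei) bviei,
    hei.isHopfIso hpoly bei, hcomp, hvi.isHopfIso hpoly bvi⟩
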